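/- Let $q\in\mathbb C$ with $0<|q|<1$. Put $(a;q)_n=\prod_{j=0}^{n-1}(1-aq^j)$, $(a;q)_\infty=\prod_{j\ge0}(1-aq^j)$, $\Omega_q=\{q^{-k}:k=0,1,2,\dots\}$; a list of parameters in the first slot means the product over the list, and for ${\bf a}=(a_1,\dots,a_A)$ we write $x{\bf a}=(xa_1,\dots,xa_A)$, $x/{\bf a}=(x/a_1,\dots,x/a_A)$, ${\bf a}/x=(a_1/x,\dots,a_A/x)$ and ${\bf a}_{[k]}$ for ${\bf a}$ with $a_k$ omitted. Let $${}_{r+1}\phi_s\left({a_1,\dots,a_{r+1}\atop b_1,\dots,b_s};q,z\right)=\sum_{n\ge0}\frac{(a_1,\dots,a_{r+1};q)_n}{(q,b_1,\dots,b_s;q)_n}\left((-1)^nq^{\binom n2}\right)^{s-r}z^n ,$$ and, for $p\in\mathbb Z$, let ${}_{r+1}\phi_s^{p}$ denote the same series after adjoining $|p|$ zeros to the upper parameters if $p<0$, respectively $p$ zeros to the lower parameters if $p>0$ (van de Bult–Rains notation). Let $m\in\mathbb Z$, $t\in\mathbb C\setminus\{0\}$, $\sigma>0$, and let ${\bf a}=(a_1,\dots,a_A)$,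 ${\bf b}=(b_1,\dots,b_B)$, ${\bf c}=(c_1,\dots,c_C)$, ${\bf d}=(d_1,\dots,d_D)$ be finite (possibly empty) lists of complex numbers with $|c_k|<\sigma/|t|$ and $|d_l|<1/\sigma$ for all $k,l$ (so that $|tc_kd_l|<1$). With $z=e^{i\psi}$ and $\sqrt t$ the principal root, $t^{m/2}=(\sqrt t)^m$, define $$G_{m,t}({\bf a},{\bf b},{\bf c},{\bf d};\sigma,q)=\frac{(q;q)_\infty}{2\pi}\left(\frac{\sqrt t}{\sigma}\right)^m\int_{-\pi}^{\pi}\frac{({\bf b}\frac{\sigma}{z},t{\bf a}\frac z\sigma;q)_\infty}{({\bf d}\frac\sigma z,t{\bf c}\frac z\sigma;q)_\infty}e^{im\psi}\,d\psi .$$ Then the integral exists, and the following hold. (i) If $|c_k|,|d_l|<\min\{1/\sigma,\sigma/|t|\}$ for all $k,l$, then $G_{m,t}({\bf a},{\bf b},{\bf c},{\bf d};\sigma,q)=G_{-m,t}({\bf b},{\bf a},{\bf d},{\bf c};\sigma,q)$. (ii) Suppose that all $d_l$ and all $b_j$ are nonzero, that $td_ka_i\notin\Omega_q$ for all $k,i$,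 and that $d_l/d_{l'}\notin\Omega_q$ for $l\ne l'$. If $D>B$, or if $D=B$ and $|q^mb_1\cdots b_B|<|d_1\cdots d_D|$, then $$G_{m,t}({\bf a},{\bf b},{\bf c},{\bf d};\sigma,q)=t^{m/2}\sum_{k=1}^D\frac{(td_k{\bf a},{\bf b}/d_k;q)_\infty\,d_k^m}{(td_k{\bf c},{\bf d}_{[k]}/d_k;q)_\infty}\;{}_{B+C}\phi_{A+D-1}^{\,C-A}\left({td_k{\bf c},\,qd_k/{\bf b}\atop td_k{\bf a},\,qd_k/{\bf d}_{[k]}};q,\;q^m(qd_k)^{D-B}\frac{b_1\cdots b_B}{d_1\cdots d_D}\right).$$ Moreover, for every $k$: if $D>B$, the series, for an arbitrary argument, converges absolutely and is an entire function of the argument; if $D=B$ and $|q^mb_1\cdots b_B|<|d_1\cdots d_D|$, the series in the formula converges absolutely; in the remaining cases ($D<B$, or $D=B$ and $|q^mb_1\cdots b_B|\ge|d_1\cdots d_D|$) it diverges whenever it is nonterminating, that is, whenever none of its upper parameters lies in $\Omega_q$. (iii) Suppose that all $c_k$ and all $a_i$ are nonzero, that $tc_kb_j\notin\Omega_q$ for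 all $k,j$, and that $c_k/c_{k'}\notin\Omega_q$ for $k\ne k'$. If $C>A$, or if $C=A$ and $|q^{-m}a_1\cdots a_A|<|c_1\cdots c_C|$, then $$G_{m,t}({\bf a},{\bf b},{\bf c},{\bf d};\sigma,q)=\frac1{t^{m/2}}\sum_{k=1}^C\frac{(tc_k{\bf b},{\bf a}/c_k;q)_\infty\,c_k^{-m}}{(tc_k{\bf d},{\bf c}_{[k]}/c_k;q)_\infty}\;{}_{A+D}\phi_{B+C-1}^{\,D-B}\left({tc_k{\bf d},\,qc_k/{\bf a}\atop tc_k{\bf b},\,qc_k/{\bf c}_{[k]}};q,\;q^{-m}(qc_k)^{C-A}\frac{a_1\cdots a_A}{c_1\cdots c_C}\right).$$ Moreover, for every $k$: if $C>A$, the series, for an arbitrary argument, converges absolutely and is an entire function of the argument; if $C=A$ and $|q^{-m}a_1\cdots a_A|<|c_1\cdots c_C|$, the series in the formula converges absolutely; in the remaining cases ($C<A$, or $C=A$ and $|q^{-m}a_1\cdots a_A|\ge|c_1\cdots c_C|$) it diverges whenever it is nonterminating, that is, whenever none of its upper parameters lies in $\Omega_q$. -/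

import Mathlib

noncomputable section

namespace QSeries

/-- The set `Ω_q = {q⁻ᵏ : k = 0, 1, 2, …}`. -/
def Omega (q : ℂ) : Set ℂ := {x | ∃ k : ℕ, x = (q ^ k)⁻¹}

/-- The finite `q`-shifted factorial `(a; q)_n = (1 - a)(1 - aq) ⋯ (1 - aq^(n-1))`. -/
def qPoch (a q : ℂ) (n : ℕ) : ℂ := ∏ j ∈ Finset.range n, (1 - a * q ^ j)

/-- The infinite `q`-shifted factorial `(a; q)_∞`; the product converges for `‖q‖ < 1`. -/
def qPochInf (a q : ℂ) : ℂ := ∏' j : ℕ, (1 - a * q ^ j)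

/-- The product `(f₁, …, fₙ; q)_∞`. -/
def qPochInfs {n : ℕ} (f : Fin n → ℂ) (q : ℂ) : ℂ := ∏ i, qPochInf (f i) q

/-- The `n`-th term of the basic hypergeometric series `_{r+1}φ_s`, where `r + 1` and `s` are the
numbers of entries (with multiplicity) of `top` and `bot`. -/
def phiTerm (top bot : Multiset ℂ) (q z : ℂ) (n : ℕ) : ℂ :=
  (top.map fun x => qPoch x q n).prod / (qPoch q q n * (bot.map fun x => qPoch x q n).prod) *
    ((-1) ^ n * q ^ n.choose 2) ^ ((bot.card : ℤ) + 1 - (top.card : ℤ)) * z ^ n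

/-- The `n`-th term of the van de Bult–Rains series `_{r+1}φ_s^p`: for `p < 0` the upper
parameters, for `p > 0` the lower parameters are supplemented by `|p|` zeros. -/
def vdBRTerm (p : ℤ) (top bot : Multiset ℂ) (q z : ℂ) (n : ℕ) : ℂ :=
  phiTerm (top + Multiset.replicate (-p).toNat 0) (bot + Multiset.replicate p.toNat 0) q z n

/-- The van de Bult–Rains series `_{r+1}φ_s^p (top; bot; q, z)`. -/
def vdBR (p : ℤ) (top bot : Multiset ℂ) (q z : ℂ) : ℂ := ∑' n, vdBRTerm p top bot q z n

section

variable {A B C D : ℕ}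

/-- The integrand `(b σ/z, t a z/σ; q)_∞ / (d σ/z, t c z/σ; q)_∞ · e^{imψ}` with `z = e^{iψ}`. -/
def integrand (m : ℤ) (t : ℂ) (a : Fin A → ℂ) (b : Fin B → ℂ) (c : Fin C → ℂ) (d : Fin D → ℂ)
    (σ : ℝ) (q : ℂ) (ψ : ℝ) : ℂ :=
  let z : ℂ := Complex.exp (Complex.I * ψ)
  (qPochInfs (fun j => b j * (σ / z)) q * qPochInfs (fun i => t * a i * (z / σ)) q) /
    (qPochInfs (fun l => d l * (σ / z)) q * qPochInfs (fun k => t * c k * (z / σ)) q) *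
    Complex.exp (Complex.I * m * ψ)

/-- `G_{m,t}(a, b, c, d; σ, q)`, with the principal square root of `t`. -/
def G (m : ℤ) (t : ℂ) (a : Fin A → ℂ) (b : Fin B → ℂ) (c : Fin C → ℂ) (d : Fin D → ℂ)
    (σ : ℝ) (q : ℂ) : ℂ :=
  qPochInf q q / (2 * Real.pi) * (Complex.sqrt t / σ) ^ m *
    ∫ ψ in (-Real.pi)..Real.pi, integrand m t a b c d σ q ψ

/-- The coefficient
`(t d_k a, b / d_k; q)_∞ d_k^m / (t d_k c, d_[k] / d_k; q)_∞`, where `d_[k]` omits `d_k`. -/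
def coeff (m : ℤ) (t : ℂ) (a : Fin A → ℂ) (b : Fin B → ℂ) (c : Fin C → ℂ) (d : Fin D → ℂ)
    (q : ℂ) (k : Fin D) : ℂ :=
  qPochInfs (fun i => t * d k * a i) q * qPochInfs (fun j => b j / d k) q * d k ^ m /
    (qPochInfs (fun i => t * d k * c i) q *
      ∏ l ∈ Finset.univ.erase k, qPochInf (d l / d k) q)

/-- The upper parameters `t d_k c, q d_k / b`. -/
def topPar (t : ℂ) (b : Fin B → ℂ) (c : Fin C → ℂ) (d : Fin D → ℂ) (q : ℂ) (k : Fin D) :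
    Multiset ℂ :=
  Finset.univ.val.map (fun i => t * d k * c i) + Finset.univ.val.map (fun j => q * d k / b j)

/-- The lower parameters `t d_k a, q d_k / d_[k]`, where `d_[k]` omits `d_k`. -/
def botPar (t : ℂ) (a : Fin A → ℂ) (d : Fin D → ℂ) (q : ℂ) (k : Fin D) : Multiset ℂ :=
  Finset.univ.val.map (fun i => t * d k * a i) +
    (Finset.univ.erase k).val.map (fun l => q * d k / d l)

/-- The argument `q^m (q d_k)^(D-B) b₁⋯b_B / (d₁⋯d_D)`. -/
def arg (m : ℤ) (b : Fin B → ℂ) (d : Fin D → ℂ) (q : ℂ) (k : Fin D) : ℂ :=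
  q ^ m * (q * d k) ^ ((D : ℤ) - B) * ((∏ j, b j) / ∏ l, d l)

end

/-- The series with terms `u 0, u 1, …` diverges: its partial sums have no limit. -/
def SeriesDiverges (u : ℕ → ℂ) : Prop :=
  ¬ ∃ s : ℂ, Filter.Tendsto (fun N => ∑ n ∈ Finset.range N, u n) Filter.atTop (nhds s)

end QSeries

end

/-!
Up to a constant, `G` is the average of a meromorphic kernel `K w`, `w = z / σ`, over the circle of
radius `1 / σ`. The factors `1 - x q ^ j` telescope, so that `K (q w) = F w * K w` with a rational
function `F`. Hence the residues of `K w / w` at the poles `d_k q ^ n` satisfy the recursion in `n`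
of the terms of the `k`-th basic hypergeometric series. The hypotheses of (ii) say that `‖F 0‖ < 1`,
so `K` decays geometrically along the circles of radius `r ‖q‖ ^ n`, and the average over the outer
circle is the sum of all residues. The substitution `w ↦ 1 / (t w)` exchanges `a` with `b`, `c` with
`d`, and `m` with `-m`; combined with a change of radius that crosses no pole it gives (i), and it
turns (ii) into (iii). The convergence of the series is that of `∑ ((-1)ⁿ q ^ (n choose 2)) ^ E zⁿ`,
`E = D - B`, because quotients of `q`-shifted factorials converge to quotients of infinite ones.
-/

open Filter Topology

section Residues

open Metric

variable {E ι : Type*} [NormedAddCommGroup E] [NormedSpace ℂ E] {f : ℂ → E} {c : ℂ} {r R : ℝ}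

theorem tendsto_limUnder_of_tendsto_sub_smul_zero [CompleteSpace E] {p : ℂ}
    (hf : ∀ᶠ w in 𝓝[≠] p, DifferentiableAt ℂ f w)
    (h : Tendsto (fun w => (w - p) • f w) (𝓝[≠] p) (𝓝 0)) :
    Tendsto f (𝓝[≠] p) (𝓝 (limUnder (𝓝[≠] p) f)) := by
  refine Complex.tendsto_limUnder_of_differentiable_on_punctured_nhds_of_isLittleO hf ?_
  have hsub : Tendsto (fun w => w - p) (𝓝[≠] p) (𝓝 0) :=
    tendsto_nhdsWithin_of_tendsto_nhds ((continuous_sub_right p).tendsto' _ _ (sub_self p))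
  have hlim := h.sub (hsub.smul_const (f p))
  simp only [← smul_sub, zero_smul, sub_zero] at hlim
  have hO := (Asymptotics.isBigO_refl (fun w => (w - p)⁻¹) (𝓝[≠] p)).smul_isLittleO
    ((Asymptotics.isLittleO_one_iff ℂ).2 hlim)
  refine hO.congr' ?_ (Eventually.of_forall fun w => by simp)
  filter_upwards [self_mem_nhdsWithin] with w hw
  exact inv_smul_smul₀ (sub_ne_zero.2 hw) _

theorem exists_continuousOn_eqOn_compl_of_removable [CompleteSpace E] {U s : Set ℂ}
    (hs : s.Finite) (hsU : s ⊆ interior U) (hf : ∀ w ∈ U \ s, DifferentiableAt ℂ f w)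
    (hlim : ∀ p ∈ s, Tendsto (fun w => (w - p) • f w) (𝓝[≠] p) (𝓝 0)) :
    ∃ g : ℂ → E, ContinuousOn g U ∧ Set.EqOn g f sᶜ := by
  classical
  set g : ℂ → E := fun w => if w ∈ s then limUnder (𝓝[≠] w) f else f w
  have hgf : Set.EqOn g f sᶜ := fun w hw => if_neg hw
  refine ⟨g, fun w hw => ContinuousAt.continuousWithinAt ?_, hgf⟩
  by_cases hws : w ∈ s
  · have hs_compl : ∀ᶠ v in 𝓝[≠] w, v ∈ sᶜ := nhdsNE_le_cofinite w hs.compl_mem_cofinite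
    have hf_near : ∀ᶠ v in 𝓝[≠] w, DifferentiableAt ℂ f v := by
      filter_upwards [mem_nhdsWithin_of_mem_nhds (mem_interior_iff_mem_nhds.1 (hsU hws)), hs_compl]
        with v hv hvs using hf v ⟨hv, hvs⟩
    have hlim_w := tendsto_limUnder_of_tendsto_sub_smul_zero hf_near (hlim w hws)
    refine continuousWithinAt_compl_self.1 ?_
    rw [ContinuousWithinAt, show g w = limUnder (𝓝[≠] w) f from if_pos hws]
    exact hlim_w.congr' (hs_compl.mono fun v hv => (hgf hv).symm)
  · exact (hf w ⟨hw, hws⟩).continuousAt.congr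
      ((hs.isClosed.isOpen_compl.eventually_mem hws).mono fun v hv => (hgf hv).symm)

theorem circleIntegral_eq_of_removable [CompleteSpace E] (hr : 0 < r) (hrR : r ≤ R) {s : Set ℂ}
    (hs : s.Finite) (hs_annulus : s ⊆ ball c R \ closedBall c r)
    (hf : ∀ w ∈ (closedBall c R \ ball c r) \ s, DifferentiableAt ℂ f w)
    (hlim : ∀ p ∈ s, Tendsto (fun w => (w - p) • f w) (𝓝[≠] p) (𝓝 0)) :
    (∮ w in C(c, R), f w) = ∮ w in C(c, r), f w := by
  have hann : ball c R \ closedBall c r ⊆ closedBall c R \ ball c r :=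
    Set.sdiff_subset_sdiff ball_subset_closedBall ball_subset_closedBall
  obtain ⟨g, hg, hgf⟩ := exists_continuousOn_eqOn_compl_of_removable hs
    (hs_annulus.trans (interior_maximal hann (isOpen_ball.sdiff isClosed_closedBall))) hf hlim
  have hcircle {ρ : ℝ} (hρ : 0 ≤ ρ) (h : sphere c ρ ⊆ sᶜ) :
      (∮ w in C(c, ρ), f w) = ∮ w in C(c, ρ), g w :=
    circleIntegral.integral_congr hρ fun w hw => (hgf (h hw)).symm
  rw [hcircle (hr.le.trans hrR) fun w hw hws =>
      sphere_disjoint_ball.notMem_of_mem_left hw (hs_annulus hws).1,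
    hcircle hr.le fun w hw hws => (hs_annulus hws).2 (sphere_subset_closedBall hw)]
  refine Complex.circleIntegral_eq_of_differentiable_on_annulus_off_countable hr hrR hs.countable
    hg fun w hw => ?_
  exact (hf w ⟨hann hw.1, hw.2⟩).congr_of_eventuallyEq
    ((hs.isClosed.isOpen_compl.eventually_mem hw.2).mono fun v hv => hgf hv)

theorem tendsto_sub_smul_sum_inv_sub_smul {p : ι → ℂ} {s : Finset ι} (hp : Set.InjOn p s)
    (res : ι → E) {i : ι} (hi : i ∈ s) :
    Tendsto (fun w => (w - p i) • ∑ j ∈ s, (w - p j)⁻¹ • res j) (𝓝[≠] p i) (𝓝 (res i)) := by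
  classical
  have hterm : ∀ j ∈ s, Tendsto (fun w => (w - p i) • (w - p j)⁻¹ • res j) (𝓝[≠] p i)
      (𝓝 (if j = i then res i else 0)) := fun j hj => by
    split_ifs with hji
    · subst hji
      refine tendsto_const_nhds.congr' ?_
      filter_upwards [self_mem_nhdsWithin] with w hw
      rw [smul_inv_smul₀ (sub_ne_zero.2 hw)]
    · have hne : p i - p j ≠ 0 := sub_ne_zero.2 fun h => hji (hp hj hi h.symm)
      have hcont : ContinuousAt (fun w => (w - p i) • (w - p j)⁻¹ • res j) (p i) :=
        (continuousAt_id.sub continuousAt_const).smul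
          (((continuousAt_id.sub continuousAt_const).inv₀ hne).smul continuousAt_const)
      simpa using tendsto_nhdsWithin_of_tendsto_nhds hcont.tendsto
  simpa [Finset.smul_sum, hi] using tendsto_finsetSum s hterm

theorem differentiableAt_sum_inv_sub_smul {p : ι → ℂ} {s : Finset ι} (res : ι → E) {w : ℂ}
    (hw : ∀ i ∈ s, w ≠ p i) :
    DifferentiableAt ℂ (fun w => ∑ i ∈ s, (w - p i)⁻¹ • res i) w :=
  .fun_sum fun i hi =>
    ((differentiableAt_id.sub_const (p i)).inv (sub_ne_zero.2 (hw i hi))).smul_const (res i)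

theorem circleIntegrable_of_differentiableAt (hR : 0 ≤ R)
    (hf : ∀ w ∈ sphere c R, DifferentiableAt ℂ f w) : CircleIntegrable f c R :=
  ContinuousOn.circleIntegrable hR fun w hw => (hf w hw).continuousAt.continuousWithinAt

theorem circleIntegral_sum_inv_sub_smul_of_mem_ball [CompleteSpace E] {p : ι → ℂ} {s : Finset ι}
    (hp : ∀ i ∈ s, p i ∈ ball c R) (res : ι → E) :
    (∮ w in C(c, R), ∑ i ∈ s, (w - p i)⁻¹ • res i) =
      (2 * Real.pi * Complex.I : ℂ) • ∑ i ∈ s, res i := by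
  rw [circleIntegral.integral_fun_sum fun i hi => ?_, Finset.smul_sum]
  · refine Finset.sum_congr rfl fun i hi => ?_
    rw [circleIntegral.integral_smul_const, circleIntegral.integral_sub_inv_of_mem_ball (hp i hi)]
  · have hR : 0 ≤ R := dist_nonneg.trans (hp i hi).le
    refine circleIntegrable_of_differentiableAt hR fun w hw => ?_
    have hne : w - p i ≠ 0 := sub_ne_zero.2 fun h =>
      sphere_disjoint_ball.notMem_of_mem_left (h ▸ hw) (hp i hi)
    exact ((differentiableAt_id.sub_const (p i)).inv hne).smul_const (res i)

theorem circleIntegral_sum_inv_sub_smul_of_notMem_closedBall [CompleteSpace E] (hr : 0 ≤ r)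
    {p : ι → ℂ} {s : Finset ι} (hp : ∀ i ∈ s, p i ∉ closedBall c r) (res : ι → E) :
    (∮ w in C(c, r), ∑ i ∈ s, (w - p i)⁻¹ • res i) = 0 := by
  have hdiff : ∀ w ∈ closedBall c r,
      DifferentiableAt ℂ (fun w => ∑ i ∈ s, (w - p i)⁻¹ • res i) w := fun w hw =>
    differentiableAt_sum_inv_sub_smul res fun i hi => ne_of_mem_of_not_mem hw (hp i hi)
  exact Complex.circleIntegral_eq_zero_of_differentiable_on_off_countable hr Set.countable_empty
    (fun w hw => (hdiff w hw).continuousAt.continuousWithinAt)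
    fun w hw => hdiff w (ball_subset_closedBall hw.1)

theorem circleIntegral_eq_add_sum_residues [CompleteSpace E] (hr : 0 < r) (hrR : r ≤ R)
    {p : ι → ℂ} {s : Finset ι} (hp : Set.InjOn p s)
    (hp_annulus : ∀ i ∈ s, p i ∈ ball c R \ closedBall c r)
    (hf : ∀ w ∈ closedBall c R \ ball c r, (∀ i ∈ s, w ≠ p i) → DifferentiableAt ℂ f w)
    {res : ι → E}
    (hres : ∀ i ∈ s, Tendsto (fun w => (w - p i) • f w) (𝓝[≠] p i) (𝓝 (res i))) :
    (∮ w in C(c, R), f w) =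
      (∮ w in C(c, r), f w) + (2 * Real.pi * Complex.I : ℂ) • ∑ i ∈ s, res i := by
  -- Without its principal parts `f` has only removable singularities.
  set P : ℂ → E := fun w => ∑ i ∈ s, (w - p i)⁻¹ • res i
  have hP : ∀ w, (∀ i ∈ s, w ≠ p i) → DifferentiableAt ℂ P w :=
    fun w => differentiableAt_sum_inv_sub_smul res
  have hremovable : (∮ w in C(c, R), f w - P w) = ∮ w in C(c, r), f w - P w := by
    refine circleIntegral_eq_of_removable hr hrR (s.finite_toSet.image p)
      (Set.image_subset_iff.2 hp_annulus) (fun w hw => ?_) (Set.forall_mem_image.2 fun i hi => ?_)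
    · have hne : ∀ i ∈ s, w ≠ p i := fun i hi h => hw.2 ⟨i, hi, h.symm⟩
      exact (hf w hw.1 hne).sub (hP w hne)
    · simpa [smul_sub] using (hres i hi).sub (tendsto_sub_smul_sum_inv_sub_smul hp res hi)
  have hsub {ρ : ℝ} (hρ : ρ ∈ Set.Icc r R) (hne : ∀ w ∈ sphere c ρ, ∀ i ∈ s, w ≠ p i) :
      (∮ w in C(c, ρ), f w - P w) = (∮ w in C(c, ρ), f w) - ∮ w in C(c, ρ), P w := by
    have hρ0 : 0 ≤ ρ := hr.le.trans hρ.1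
    refine circleIntegral.integral_sub (circleIntegrable_of_differentiableAt hρ0 fun w hw => ?_)
      (circleIntegrable_of_differentiableAt hρ0 fun w hw => hP w (hne w hw))
    rw [mem_sphere] at hw
    exact hf w ⟨hw.trans_le hρ.2, not_lt.2 (hρ.1.trans_eq hw.symm)⟩ (hne w hw)
  rw [hsub ⟨hrR, le_rfl⟩ fun w hw i hi h =>
      sphere_disjoint_ball.notMem_of_mem_left (h ▸ hw) (hp_annulus i hi).1,
    hsub ⟨le_rfl, hrR⟩ fun w hw i hi h => (hp_annulus i hi).2 (h ▸ sphere_subset_closedBall hw),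
    circleIntegral_sum_inv_sub_smul_of_mem_ball fun i hi => (hp_annulus i hi).1,
    circleIntegral_sum_inv_sub_smul_of_notMem_closedBall hr.le fun i hi => (hp_annulus i hi).2,
    sub_zero] at hremovable
  exact sub_eq_iff_eq_add.1 hremovable

-- As `circleAverage f 0 R` integrates `f w / w`, the residue at `p` is the limit of
-- `(w - p) * f w / w = (1 - p / w) * f w`.
theorem circleAverage_eq_add_sum_residues [CompleteSpace E] (hr : 0 < r) (hrR : r ≤ R)
    {p : ι → ℂ} {s : Finset ι} (hp : Set.InjOn p s) (hp_annulus : ∀ i ∈ s, r < ‖p i‖ ∧ ‖p i‖ < R)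
    (hf : ∀ w, r ≤ ‖w‖ → ‖w‖ ≤ R → (∀ i ∈ s, w ≠ p i) → DifferentiableAt ℂ f w) {res : ι → E}
    (hres : ∀ i ∈ s, Tendsto (fun w => (1 - p i / w) • f w) (𝓝[≠] p i) (𝓝 (res i))) :
    Real.circleAverage f 0 R = Real.circleAverage f 0 r + ∑ i ∈ s, res i := by
  have hne : ∀ w : ℂ, r ≤ ‖w‖ → w ≠ 0 := fun w hw => norm_pos_iff.1 (hr.trans_le hw)
  have hsum := circleIntegral_eq_add_sum_residues (f := fun w => (w - 0)⁻¹ • f w) (c := 0) hr hrR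
    hp (fun i hi => by simpa using (hp_annulus i hi).symm)
    (fun w hw hws => by
      simp only [Set.mem_sdiff, mem_closedBall_zero_iff, mem_ball_zero_iff, not_lt] at hw
      exact ((differentiableAt_id.sub_const 0).inv (by simpa using hne w hw.2)).smul
        (hf w hw.2 hw.1 hws))
    (fun i hi => (hres i hi).congr' <| by
      have hp0 : p i ≠ 0 := hne _ (hp_annulus i hi).1.le
      filter_upwards [mem_nhdsWithin_of_mem_nhds (isOpen_ne.mem_nhds hp0)] with w hw
      rw [smul_smul, sub_zero, sub_mul, mul_inv_cancel₀ hw, div_eq_mul_inv])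
  rw [Real.circleAverage_eq_circleIntegral (hr.trans_le hrR).ne',
    Real.circleAverage_eq_circleIntegral hr.ne', hsum, smul_add,
    inv_smul_smul₀ Complex.two_pi_I_ne_zero]

end Residues

section ResidueSeries

open Metric

theorem norm_le_pow_mul_of_norm_mul_le {E : Type*} [Norm E] {f : ℂ → E} {q : ℂ} (hq0 : q ≠ 0)
    (hq : ‖q‖ < 1) {ρ r M : ℝ} (hρ : 0 ≤ ρ) (hr : 0 < r)
    (hdecay : ∀ w, w ≠ 0 → ‖w‖ ≤ r → ‖f (q * w)‖ ≤ ρ * ‖f w‖)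
    (hM : ∀ w ∈ sphere 0 r, ‖f w‖ ≤ M) (n : ℕ) :
    ∀ w ∈ sphere 0 (r * ‖q‖ ^ n), ‖f w‖ ≤ ρ ^ n * M := by
  have hqpos : 0 < ‖q‖ := norm_pos_iff.2 hq0
  induction n with
  | zero => simpa using hM
  | succ n ih =>
    intro w hw
    have hnorm : ‖q⁻¹ * w‖ = r * ‖q‖ ^ n := by
      rw [mem_sphere_zero_iff_norm] at hw
      rw [norm_mul, hw, norm_inv, pow_succ]
      field_simp
    calc ‖f w‖ = ‖f (q * (q⁻¹ * w))‖ := by rw [mul_inv_cancel_left₀ hq0]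
      _ ≤ ρ * ‖f (q⁻¹ * w)‖ := hdecay _ (norm_pos_iff.1 (hnorm ▸ by positivity))
          (hnorm ▸ mul_le_of_le_one_right hr.le (pow_le_one₀ hqpos.le hq.le))
      _ ≤ ρ * (ρ ^ n * M) := by
          gcongr
          exact ih _ (mem_sphere_zero_iff_norm.2 hnorm)
      _ = ρ ^ (n + 1) * M := by ring

variable {E ι : Type*} [NormedAddCommGroup E] [NormedSpace ℂ E] {f : ℂ → E} {q : ℂ}

theorem norm_circleAverage_le_of_norm_le {c : ℂ} {R M : ℝ} (h : ∀ w ∈ sphere c |R|, ‖f w‖ ≤ M) :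
    ‖Real.circleAverage f c R‖ ≤ M := by
  have hint := intervalIntegral.norm_integral_le_of_norm_le_const (a := 0) (b := 2 * Real.pi)
    fun θ _ => h (circleMap c R θ) (circleMap_mem_sphere' c R θ)
  rw [Real.circleAverage_def, norm_smul, norm_inv, Real.norm_of_nonneg Real.two_pi_pos.le]
  rw [sub_zero, abs_of_pos Real.two_pi_pos, mul_comm M] at hint
  exact inv_mul_le_of_le_mul₀ Real.two_pi_pos.le ((norm_nonneg _).trans
    (h _ (circleMap_mem_sphere' c R 0))) hint

theorem tendsto_one_sub_div_smul_of_mul (hq0 : q ≠ 0) {F : ℂ → ℂ} {p : ℂ} {L : E}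
    (hfF : ∀ᶠ v in 𝓝[≠] p, f (q * v) = F v • f v) (hF : ContinuousAt F p)
    (hf : Tendsto (fun v => (1 - p / v) • f v) (𝓝[≠] p) (𝓝 L)) :
    Tendsto (fun w => (1 - q * p / w) • f w) (𝓝[≠] (q * p)) (𝓝 (F p • L)) := by
  have hscale : Tendsto (fun w => q⁻¹ * w) (𝓝[≠] (q * p)) (𝓝[≠] p) := by
    refine tendsto_nhdsWithin_iff.2 ⟨tendsto_nhdsWithin_of_tendsto_nhds
      ((continuous_const_mul q⁻¹).tendsto' _ _ (inv_mul_cancel_left₀ hq0 p)), ?_⟩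
    filter_upwards [self_mem_nhdsWithin] with w hw h
    exact hw ((inv_mul_eq_iff_eq_mul₀ hq0).1 h)
  have hlim := (tendsto_nhdsWithin_of_tendsto_nhds hF.tendsto).smul hf
  refine (hlim.comp hscale).congr' ?_
  filter_upwards [hscale.eventually hfF] with w hw
  rw [mul_inv_cancel_left₀ hq0] at hw
  rw [Function.comp_apply, smul_comm, ← hw, ← div_eq_inv_mul, div_div_eq_mul_div, mul_comm p]

theorem tendsto_circleAverage_mul_pow_zero (hq0 : q ≠ 0) (hq : ‖q‖ < 1) {ρ r : ℝ} (hρ0 : 0 ≤ ρ)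
    (hρ : ρ < 1) (hr : 0 < r) (hdecay : ∀ w, w ≠ 0 → ‖w‖ ≤ r → ‖f (q * w)‖ ≤ ρ * ‖f w‖)
    (hf : ContinuousOn f (sphere 0 r)) :
    Tendsto (fun n : ℕ => Real.circleAverage f 0 (r * ‖q‖ ^ n)) atTop (𝓝 0) := by
  obtain ⟨M, hM⟩ := (isCompact_sphere (0 : ℂ) r).exists_bound_of_continuousOn hf
  have hlim : Tendsto (fun n : ℕ => ρ ^ n * M) atTop (𝓝 0) := by
    simpa using (tendsto_pow_atTop_nhds_zero_of_lt_one hρ0 hρ).mul_const M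
  refine squeeze_zero_norm (fun n => norm_circleAverage_le_of_norm_le ?_) hlim
  rw [abs_of_nonneg (by positivity)]
  exact norm_le_pow_mul_of_norm_mul_le hq0 hq hρ0 hr hdecay hM n

variable [CompleteSpace E]

theorem circleAverage_eq_tsum_residues {p : ι → ℂ} (hp : Function.Injective p)
    (hp_lim : Tendsto p cofinite (𝓝 0)) {R : ℝ} (hpR : ∀ i, ‖p i‖ < R)
    (hf : ∀ w, w ≠ 0 → ‖w‖ ≤ R → w ∉ Set.range p → DifferentiableAt ℂ f w) {res : ι → E}
    (hres : ∀ i, Tendsto (fun w => (1 - p i / w) • f w) (𝓝[≠] p i) (𝓝 (res i)))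
    (hsum : Summable res) {r : ℕ → ℝ} (hr : ∀ n, r n ∈ Set.Ioc 0 R) (hr_anti : Antitone r)
    (hr_lim : Tendsto r atTop (𝓝 0)) (hpr : ∀ n i, ‖p i‖ ≠ r n) (hp0 : ∀ i, p i ≠ 0)
    (hlim : Tendsto (fun n => Real.circleAverage f 0 (r n)) atTop (𝓝 0)) :
    Real.circleAverage f 0 R = ∑' i, res i := by
  have hfinite (n : ℕ) : {i | r n < ‖p i‖}.Finite := by
    simpa [Filter.Eventually, Set.compl_ofPred] using
      hp_lim.norm.eventually_le_const (by simpa using (hr n).1)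
  set s : ℕ → Finset ι := fun n => (hfinite n).toFinset
  have hmem {n : ℕ} {i : ι} : i ∈ s n ↔ r n < ‖p i‖ := (hfinite n).mem_toFinset
  have hs : Tendsto s atTop atTop := by
    refine tendsto_atTop_finset_of_monotone (fun m n hmn i hi => ?_) fun i => ?_
    · exact hmem.2 ((hr_anti hmn).trans_lt (hmem.1 hi))
    · obtain ⟨n, hn⟩ := (hr_lim.eventually_lt_const (norm_pos_iff.2 (hp0 i))).exists
      exact ⟨n, hmem.2 hn⟩
  have hresidues (n : ℕ) :
      Real.circleAverage f 0 R = Real.circleAverage f 0 (r n) + ∑ i ∈ s n, res i := by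
    refine circleAverage_eq_add_sum_residues (hr n).1 (hr n).2 hp.injOn
      (fun i hi => ⟨hmem.1 hi, hpR i⟩) (fun w hrw hwR hws => ?_) fun i _ => hres i
    refine hf w (norm_pos_iff.1 ((hr n).1.trans_le hrw)) hwR ?_
    rintro ⟨i, rfl⟩
    exact hws i (hmem.2 (hrw.lt_of_ne (hpr n i).symm)) rfl
  have hsums := hlim.add (hsum.hasSum.comp hs)
  simp only [Function.comp_apply, ← hresidues, zero_add] at hsums
  exact tendsto_nhds_unique tendsto_const_nhds hsums

theorem circleAverage_eq_tsum_residues_of_norm_mul_le [Countable ι] (hq0 : q ≠ 0) (hq : ‖q‖ < 1)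
    {p : ι → ℂ} (hp : Function.Injective p) (hp0 : ∀ i, p i ≠ 0)
    (hp_lim : Tendsto p cofinite (𝓝 0)) {R : ℝ} (hR : 0 < R) (hpR : ∀ i, ‖p i‖ < R)
    (hf : ∀ w, w ≠ 0 → ‖w‖ ≤ R → w ∉ Set.range p → DifferentiableAt ℂ f w) {res : ι → E}
    (hres : ∀ i, Tendsto (fun w => (1 - p i / w) • f w) (𝓝[≠] p i) (𝓝 (res i)))
    (hsum : Summable res) {ρ : ℝ} (hρ0 : 0 ≤ ρ) (hρ : ρ < 1)
    (hdecay : ∀ᶠ w in 𝓝[≠] 0, ‖f (q * w)‖ ≤ ρ * ‖f w‖) :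
    Real.circleAverage f 0 R = ∑' i, res i := by
  have hqpos : 0 < ‖q‖ := norm_pos_iff.2 hq0
  obtain ⟨δ, hδ, hdecay⟩ := (nhdsWithin_hasBasis nhds_basis_closedBall _).eventually_iff.1 hdecay
  -- A generic `r` keeps all circles of radius `r * ‖q‖ ^ n` away from the countably many poles.
  obtain ⟨r, hr_generic, hr, hrδR⟩ :=
    ((Set.countable_range fun x : ι × ℕ => ‖p x.1‖ / ‖q‖ ^ x.2).dense_compl ℝ).exists_between
      (lt_min hδ hR)
  have hpr (n : ℕ) (i : ι) : ‖p i‖ ≠ r * ‖q‖ ^ n := fun h =>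
    hr_generic ⟨(i, n), (div_eq_iff (by positivity)).2 h⟩
  refine circleAverage_eq_tsum_residues hp hp_lim hpR hf hres hsum (r := fun n => r * ‖q‖ ^ n)
    (fun n => ⟨by positivity, ?_⟩) ?_ ?_ hpr hp0 ?_
  · exact (mul_le_of_le_one_right hr.le (pow_le_one₀ hqpos.le hq.le)).trans
      (hrδR.le.trans (min_le_right _ _))
  · exact fun m n hmn => by
      have := pow_le_pow_of_le_one hqpos.le hq.le hmn
      dsimp only
      gcongr
  · simpa using (tendsto_pow_atTop_nhds_zero_of_lt_one hqpos.le hq).const_mul r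
  · refine tendsto_circleAverage_mul_pow_zero hq0 hq hρ0 hρ hr (fun w hw hwr => ?_) fun w hw => ?_
    · exact hdecay ⟨by simpa using hwr.trans (hrδR.le.trans (min_le_left _ _)), hw⟩
    · rw [mem_sphere_zero_iff_norm] at hw
      refine (hf w (norm_pos_iff.1 (hw ▸ hr)) (hw ▸ hrδR.le.trans (min_le_right _ _))
        ?_).continuousAt.continuousWithinAt
      rintro ⟨i, rfl⟩
      exact hpr 0 i (by simpa using hw)

end ResidueSeries

section CircleAverage

variable {E : Type*} [NormedAddCommGroup E] [NormedSpace ℝ E] (f : ℂ → E)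

theorem circleAverage_comp_const_mul (s : ℂ) (R : ℝ) :
    Real.circleAverage (fun w => f (s * w)) 0 R = Real.circleAverage f 0 (‖s‖ * R) := by
  rw [Real.circleAverage_eq_integral_add (f := f) s.arg, Real.circleAverage_def]
  congr! 4 with θ
  conv_lhs => rw [← Complex.norm_mul_exp_arg_mul_I s]
  simp only [circleMap, zero_add]
  push_cast
  rw [add_mul, Complex.exp_add]
  ring

theorem circleAverage_comp_inv (R : ℝ) :
    Real.circleAverage (fun w => f w⁻¹) 0 R = Real.circleAverage f 0 R⁻¹ := by
  rw [Real.circleAverage_eq_circleAverage_zero_one, ← Real.circleAverage_zero_one_congr_inv,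
    Real.circleAverage_eq_circleAverage_zero_one (f := f)]
  simp [mul_comm]

end CircleAverage

namespace QSeries

variable {q : ℂ}

theorem summable_norm_mul_pow (hq : ‖q‖ < 1) (x : ℂ) :
    Summable fun j : ℕ => ‖-(x * q ^ j)‖ := by
  simp only [norm_neg, norm_mul, norm_pow]
  exact (summable_geometric_of_lt_one (norm_nonneg q) hq).mul_left _

theorem tendsto_qPoch (hq : ‖q‖ < 1) (x : ℂ) :
    Tendsto (qPoch x q) atTop (𝓝 (qPochInf x q)) := by
  have h := multipliable_one_add_of_summable (summable_norm_mul_pow hq x)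
  simp only [← sub_eq_add_neg] at h
  exact h.hasProd.tendsto_prod_nat

theorem qPoch_zero_left (n : ℕ) : qPoch 0 q n = 1 := by simp [qPoch]

theorem qPoch_zero_right (x : ℂ) : qPoch x q 0 = 1 := by simp [qPoch]

theorem qPoch_succ (x : ℂ) (n : ℕ) : qPoch x q (n + 1) = qPoch x q n * (1 - x * q ^ n) :=
  Finset.prod_range_succ _ _

theorem qPoch_succ' (x : ℂ) (n : ℕ) : qPoch x q (n + 1) = (1 - x) * qPoch (x * q) q n := by
  rw [qPoch, Finset.prod_range_succ', mul_comm, qPoch]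
  simp [pow_succ', mul_assoc]

theorem qPochInf_eq_one_sub_mul (hq : ‖q‖ < 1) (x : ℂ) :
    qPochInf x q = (1 - x) * qPochInf (x * q) q := by
  refine tendsto_nhds_unique ((tendsto_qPoch hq x).comp (tendsto_add_atTop_nat 1)) ?_
  refine ((tendsto_qPoch hq (x * q)).const_mul (1 - x)).congr fun n => ?_
  simp [qPoch_succ']

theorem one_sub_mul_pow_ne_zero {x : ℂ} (hx : x ∉ Omega q) (j : ℕ) : 1 - x * q ^ j ≠ 0 :=
  fun h => hx ⟨j, eq_inv_of_mul_eq_one_left (by linear_combination -h)⟩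

theorem qPochInf_ne_zero (hq : ‖q‖ < 1) {x : ℂ} (hx : x ∉ Omega q) : qPochInf x q ≠ 0 := by
  have h := tprod_one_add_ne_zero_of_summable (f := fun j : ℕ => -(x * q ^ j))
    (fun j => by simpa only [← sub_eq_add_neg] using one_sub_mul_pow_ne_zero hx j)
    (summable_norm_mul_pow hq x)
  simpa only [qPochInf, sub_eq_add_neg] using h

theorem notMem_Omega_of_norm_lt_one (hq0 : q ≠ 0) (hq : ‖q‖ < 1) {x : ℂ} (hx : ‖x‖ < 1) :
    x ∉ Omega q := by
  rintro ⟨k, rfl⟩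
  rw [norm_inv, norm_pow] at hx
  exact absurd hx (not_lt.2 ((one_le_inv₀ (pow_pos (norm_pos_iff.2 hq0) _)).2
    (pow_le_one₀ (norm_nonneg _) hq.le)))

theorem qPochInf_self_ne_zero (hq0 : q ≠ 0) (hq : ‖q‖ < 1) : qPochInf q q ≠ 0 :=
  qPochInf_ne_zero hq (notMem_Omega_of_norm_lt_one hq0 hq hq)

theorem differentiable_qPochInf (hq : ‖q‖ < 1) : Differentiable ℂ fun x => qPochInf x q := by
  intro x
  have hU : IsOpen (Metric.ball (0 : ℂ) (‖x‖ + 1)) := Metric.isOpen_ball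
  have hs : Summable fun j : ℕ => (‖x‖ + 1) * ‖q‖ ^ j :=
    (summable_geometric_of_lt_one (norm_nonneg q) hq).mul_left _
  have hprod := hs.hasProdLocallyUniformlyOn_nat_one_add
    (f := fun (j : ℕ) (y : ℂ) => -(y * q ^ j)) hU (Eventually.of_forall fun j y hy => by
      rw [norm_neg, norm_mul, norm_pow]
      have : ‖y‖ < ‖x‖ + 1 := by simpa using hy
      gcongr) (fun j => by fun_prop)
  have hdiff := hprod.tendstoLocallyUniformlyOn_finsetRange.differentiableOn
    (Eventually.of_forall fun n => by fun_prop) hU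
  simpa only [qPochInf, sub_eq_add_neg] using hdiff.differentiableAt (hU.mem_nhds (by simp))

/-- The factor `((-1)ⁿ q^(n choose 2))^E zⁿ` of the terms of a basic hypergeometric series. -/
noncomputable def gaussTerm (E : ℤ) (q z : ℂ) (n : ℕ) : ℂ := ((-1) ^ n * q ^ n.choose 2) ^ E * z ^ n

theorem gaussTerm_succ (E : ℤ) (q z : ℂ) (n : ℕ) :
    gaussTerm E q z (n + 1) = gaussTerm E q z n * ((-q ^ n) ^ E * z) := by
  have h : (-1 : ℂ) ^ (n + 1) * q ^ (n + 1).choose 2 = (-1) ^ n * q ^ n.choose 2 * (-q ^ n) := by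
    rw [Nat.choose_succ_succ', Nat.choose_one_right]
    ring
  rw [gaussTerm, gaussTerm, h, mul_zpow _ (-q ^ n)]
  ring

theorem gaussTerm_ne_zero (hq0 : q ≠ 0) (E : ℤ) {z : ℂ} (hz : z ≠ 0) (n : ℕ) :
    gaussTerm E q z n ≠ 0 :=
  mul_ne_zero (zpow_ne_zero _ (mul_ne_zero (pow_ne_zero _ (by norm_num)) (pow_ne_zero _ hq0)))
    (pow_ne_zero _ hz)

theorem norm_neg_pow_zpow_mul (E : ℤ) (q z : ℂ) (n : ℕ) :
    ‖(-q ^ n) ^ E * z‖ = (‖q‖ ^ E) ^ n * ‖z‖ := by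
  rw [norm_mul, norm_zpow, norm_neg, norm_pow, ← zpow_natCast, ← zpow_natCast, ← zpow_mul,
    ← zpow_mul, mul_comm (n : ℤ)]

theorem summable_gaussTerm (hq : ‖q‖ < 1) {E : ℤ} {z : ℂ} (h : 0 < E ∨ E = 0 ∧ ‖z‖ < 1) :
    Summable (gaussTerm E q z) := by
  obtain ⟨ρ, hρ, hle⟩ : ∃ ρ < (1 : ℝ), ∀ᶠ n in atTop, ‖(-q ^ n) ^ E * z‖ ≤ ρ := by
    rcases h with hE | ⟨rfl, hz⟩
    · have hqE : ‖q‖ ^ E < 1 := by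
        lift E to ℕ using hE.le
        rw [zpow_natCast]
        exact pow_lt_one₀ (norm_nonneg q) hq (by lia)
      have hlim := (tendsto_pow_atTop_nhds_zero_of_lt_one (by positivity) hqE).mul_const ‖z‖
      rw [zero_mul] at hlim
      refine ⟨1 / 2, by norm_num, ?_⟩
      filter_upwards [hlim.eventually_le_const (by norm_num : (0 : ℝ) < 1 / 2)] with n hn
      rwa [norm_neg_pow_zpow_mul]
    · exact ⟨‖z‖, hz, Eventually.of_forall fun n => by simp⟩
  refine summable_of_ratio_norm_eventually_le hρ ?_
  filter_upwards [hle] with n hn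
  rw [gaussTerm_succ, norm_mul, mul_comm]
  gcongr

theorem not_tendsto_gaussTerm_zero (hq0 : q ≠ 0) (hq : ‖q‖ < 1) {E : ℤ} {z : ℂ} (hz : z ≠ 0)
    (h : E < 0 ∨ E = 0 ∧ 1 ≤ ‖z‖) : ¬ Tendsto (gaussTerm E q z) atTop (𝓝 0) := by
  obtain ⟨N, hN⟩ : ∃ N, ∀ n ≥ N, 1 ≤ ‖(-q ^ n) ^ E * z‖ := by
    rcases h with hE | ⟨rfl, hz⟩
    · have hqE : 1 < ‖q‖ ^ E := one_lt_zpow_of_neg₀ (norm_pos_iff.2 hq0) hq hE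
      have hlim := (tendsto_pow_atTop_atTop_of_one_lt hqE).atTop_mul_const (norm_pos_iff.2 hz)
      obtain ⟨N, hN⟩ := eventually_atTop.1 (hlim.eventually_ge_atTop 1)
      exact ⟨N, fun n hn => by rw [norm_neg_pow_zpow_mul]; exact hN n hn⟩
    · exact ⟨0, fun n _ => by simpa using hz⟩
  have hle : ∀ n ≥ N, ‖gaussTerm E q z N‖ ≤ ‖gaussTerm E q z n‖ := fun n hn => by
    induction n, hn using Nat.le_induction with
    | base => exact le_rfl
    | succ n hn ih =>
      rw [gaussTerm_succ, norm_mul]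
      exact ih.trans (le_mul_of_one_le_right (norm_nonneg _) (hN n hn))
  intro hlim
  have h0 : ‖gaussTerm E q z N‖ ≤ 0 :=
    ge_of_tendsto (by simpa using hlim.norm) (eventually_atTop.2 ⟨N, hle⟩)
  exact gaussTerm_ne_zero hq0 E hz N (norm_le_zero_iff.1 h0)

/-- The quotient of `q`-shifted factorials in the terms of a basic hypergeometric series. -/
noncomputable def pochRatio (top bot : Multiset ℂ) (q : ℂ) (n : ℕ) : ℂ :=
  (top.map fun x => qPoch x q n).prod / (qPoch q q n * (bot.map fun x => qPoch x q n).prod)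

theorem pochRatio_succ (top bot : Multiset ℂ) (q : ℂ) (n : ℕ) :
    pochRatio top bot q (n + 1) = pochRatio top bot q n *
      ((top.map fun x => 1 - x * q ^ n).prod /
        ((1 - q * q ^ n) * (bot.map fun x => 1 - x * q ^ n).prod)) := by
  simp only [pochRatio, qPoch_succ, Multiset.prod_map_mul, div_mul_div_comm]
  ring

theorem multiset_prod_qPochInf_ne_zero (hq : ‖q‖ < 1) {s : Multiset ℂ}
    (hs : ∀ x ∈ s, x ∉ Omega q) : (s.map fun x => qPochInf x q).prod ≠ 0 := by
  refine Multiset.prod_ne_zero fun h0 => ?_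
  obtain ⟨x, hx, h0⟩ := Multiset.mem_map.1 h0
  exact qPochInf_ne_zero hq (hs x hx) h0

theorem tendsto_pochRatio (hq0 : q ≠ 0) (hq : ‖q‖ < 1) (top : Multiset ℂ) {bot : Multiset ℂ}
    (hbot : ∀ y ∈ bot, y ∉ Omega q) :
    Tendsto (pochRatio top bot q) atTop (𝓝 ((top.map fun x => qPochInf x q).prod /
      (qPochInf q q * (bot.map fun x => qPochInf x q).prod))) := by
  have h (s : Multiset ℂ) : Tendsto (fun n => (s.map fun x => qPoch x q n).prod) atTop
      (𝓝 (s.map fun x => qPochInf x q).prod) :=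
    tendsto_multiset_prod s fun x _ => tendsto_qPoch hq x
  exact (h top).div ((tendsto_qPoch hq q).mul (h bot))
    (mul_ne_zero (qPochInf_self_ne_zero hq0 hq) (multiset_prod_qPochInf_ne_zero hq hbot))

theorem vdBRTerm_eq (p : ℤ) (top bot : Multiset ℂ) (q z : ℂ) (n : ℕ) :
    vdBRTerm p top bot q z n =
      pochRatio top bot q n * gaussTerm ((bot.card : ℤ) + 1 - top.card + p) q z n := by
  have h : ((bot + Multiset.replicate p.toNat 0).card : ℤ) + 1 -
      ((top + Multiset.replicate (-p).toNat 0).card : ℤ) = (bot.card : ℤ) + 1 - top.card + p := by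
    simp only [Multiset.card_add, Multiset.card_replicate, Nat.cast_add]
    lia
  rw [vdBRTerm, phiTerm, h, pochRatio, gaussTerm]
  simp [qPoch_zero_left, mul_assoc]

theorem vdBRTerm_zero (p : ℤ) (top bot : Multiset ℂ) (q z : ℂ) :
    vdBRTerm p top bot q z 0 = 1 := by
  simp [vdBRTerm, phiTerm, qPoch_zero_right]

theorem vdBRTerm_succ (p : ℤ) (top bot : Multiset ℂ) (q z : ℂ) (n : ℕ) :
    vdBRTerm p top bot q z (n + 1) =
      (top.map fun x => 1 - x * q ^ n).prod /
        ((1 - q * q ^ n) * (bot.map fun x => 1 - x * q ^ n).prod) *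
      ((-q ^ n) ^ ((bot.card : ℤ) + 1 - top.card + p) * z) * vdBRTerm p top bot q z n := by
  rw [vdBRTerm_eq, vdBRTerm_eq, pochRatio_succ, gaussTerm_succ]
  ring

theorem summable_vdBRTerm (hq0 : q ≠ 0) (hq : ‖q‖ < 1) {p : ℤ} {top bot : Multiset ℂ}
    (hbot : ∀ y ∈ bot, y ∉ Omega q) {z : ℂ}
    (h : 0 < (bot.card : ℤ) + 1 - top.card + p ∨
      (bot.card : ℤ) + 1 - top.card + p = 0 ∧ ‖z‖ < 1) :
    Summable (vdBRTerm p top bot q z) := by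
  have hO := ((tendsto_pochRatio hq0 hq top hbot).isBigO_one ℂ).mul
    (Asymptotics.isBigO_refl (gaussTerm ((bot.card : ℤ) + 1 - top.card + p) q z) atTop)
  simp only [← vdBRTerm_eq, one_mul] at hO
  exact summable_of_isBigO_nat (summable_gaussTerm hq h).norm hO.norm_right

theorem vdBRTerm_eq_mul_pow (p : ℤ) (top bot : Multiset ℂ) (q z : ℂ) (n : ℕ) :
    vdBRTerm p top bot q z n = vdBRTerm p top bot q 1 n * z ^ n := by
  simp [vdBRTerm, phiTerm]

theorem differentiable_vdBR {p : ℤ} {top bot : Multiset ℂ}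
    (h : ∀ z, Summable (vdBRTerm p top bot q z)) :
    Differentiable ℂ fun z => vdBR p top bot q z := by
  intro x
  refine (Complex.differentiableOn_tsum_of_summable_norm (h ((‖x‖ + 1 : ℝ) : ℂ)).norm
    (U := Metric.ball 0 (‖x‖ + 1)) (fun n => ?_) Metric.isOpen_ball
    (fun n w hw => ?_)).differentiableAt (Metric.isOpen_ball.mem_nhds (by simp))
  · exact DifferentiableOn.congr (f := fun z => vdBRTerm p top bot q 1 n * z ^ n) (by fun_prop)
      fun z _ => vdBRTerm_eq_mul_pow p top bot q z n
  · rw [vdBRTerm_eq_mul_pow, vdBRTerm_eq_mul_pow _ _ _ _ ((‖x‖ + 1 : ℝ) : ℂ), norm_mul, norm_mul,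
      norm_pow, norm_pow, Complex.norm_real, Real.norm_of_nonneg (by positivity)]
    have : ‖w‖ < ‖x‖ + 1 := by simpa using hw
    gcongr

theorem seriesDiverges_of_not_tendsto_zero {u : ℕ → ℂ} (h : ¬ Tendsto u atTop (𝓝 0)) :
    SeriesDiverges u := by
  rintro ⟨s, hs⟩
  refine h ?_
  simpa [Finset.sum_range_succ] using (hs.comp (tendsto_add_atTop_nat 1)).sub hs

theorem seriesDiverges_vdBRTerm (hq0 : q ≠ 0) (hq : ‖q‖ < 1) {p : ℤ} {top bot : Multiset ℂ}
    (htop : ∀ x ∈ top, x ∉ Omega q) (hbot : ∀ y ∈ bot, y ∉ Omega q) {z : ℂ} (hz : z ≠ 0)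
    (h : (bot.card : ℤ) + 1 - top.card + p < 0 ∨
      (bot.card : ℤ) + 1 - top.card + p = 0 ∧ 1 ≤ ‖z‖) :
    SeriesDiverges (vdBRTerm p top bot q z) := by
  refine seriesDiverges_of_not_tendsto_zero fun hlim => not_tendsto_gaussTerm_zero hq0 hq hz h ?_
  have hratio := tendsto_pochRatio hq0 hq top hbot
  have hne := div_ne_zero (multiset_prod_qPochInf_ne_zero hq htop)
    (mul_ne_zero (qPochInf_self_ne_zero hq0 hq) (multiset_prod_qPochInf_ne_zero hq hbot))
  have hquot := hlim.div hratio hne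
  rw [zero_div] at hquot
  refine hquot.congr' ?_
  filter_upwards [hratio.eventually_ne hne] with n hn
  rw [Pi.div_apply, vdBRTerm_eq, mul_div_cancel_left₀ _ hn]

variable {A B C D : ℕ} {t : ℂ} {a : Fin A → ℂ} {b : Fin B → ℂ} {c : Fin C → ℂ} {d : Fin D → ℂ}

theorem qPochInfs_ne_zero (hq : ‖q‖ < 1) {n : ℕ} {f : Fin n → ℂ} (hf : ∀ i, f i ∉ Omega q) :
    qPochInfs f q ≠ 0 :=
  Finset.prod_ne_zero_iff.2 fun i _ => qPochInf_ne_zero hq (hf i)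

theorem qPochInfs_eq_prod_mul (hq : ‖q‖ < 1) {n : ℕ} (f : Fin n → ℂ) :
    qPochInfs f q = (∏ i, (1 - f i)) * qPochInfs (fun i => f i * q) q := by
  simp only [qPochInfs, ← Finset.prod_mul_distrib, ← qPochInf_eq_one_sub_mul hq]

theorem differentiableAt_qPochInfs (hq : ‖q‖ < 1) {n : ℕ} {f : Fin n → ℂ → ℂ} {w : ℂ}
    (hf : ∀ i, DifferentiableAt ℂ (f i) w) :
    DifferentiableAt ℂ (fun w => qPochInfs (fun i => f i w) q) w := by
  unfold qPochInfs
  exact DifferentiableAt.fun_finsetProd fun i _ =>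
    (differentiable_qPochInf hq (f i w)).comp w (hf i)

theorem differentiableAt_qPochInfs_div (hq : ‖q‖ < 1) {n : ℕ} (f : Fin n → ℂ) {w : ℂ}
    (hw : w ≠ 0) : DifferentiableAt ℂ (fun w => qPochInfs (fun i => f i / w) q) w :=
  differentiableAt_qPochInfs hq fun i => by fun_prop (disch := assumption)

theorem differentiableAt_qPochInfs_mul (hq : ‖q‖ < 1) {n : ℕ} (f : Fin n → ℂ) (w : ℂ) :
    DifferentiableAt ℂ (fun w => qPochInfs (fun i => f i * w) q) w :=
  differentiableAt_qPochInfs hq fun i => by fun_prop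

/-- The integrand of `G` as a function of `w = z / σ`, up to the constant factor `σ ^ m`. -/
noncomputable def kernel (m : ℤ) (t : ℂ) (a : Fin A → ℂ) (b : Fin B → ℂ) (c : Fin C → ℂ)
    (d : Fin D → ℂ) (q w : ℂ) : ℂ :=
  (qPochInfs (fun j => b j / w) q * qPochInfs (fun i => t * a i * w) q) /
    (qPochInfs (fun l => d l / w) q * qPochInfs (fun k => t * c k * w) q) * w ^ m

theorem integrand_eq {σ : ℝ} (hσ : 0 < σ) (m : ℤ) (ψ : ℝ) :
    integrand m t a b c d σ q ψ = (σ : ℂ) ^ m * kernel m t a b c d q (circleMap 0 (1 / σ) ψ) := by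
  have hσ' : (σ : ℂ) ≠ 0 := by exact_mod_cast hσ.ne'
  have hw : circleMap 0 (1 / σ) ψ = Complex.exp (Complex.I * ψ) / σ := by
    rw [circleMap, zero_add, mul_comm Complex.I]
    push_cast
    ring
  have hz : Complex.exp (Complex.I * m * ψ) = Complex.exp (Complex.I * ψ) ^ m := by
    rw [← Complex.exp_int_mul]
    ring_nf
  rw [hw, integrand, kernel, hz, div_zpow, mul_left_comm, mul_div_cancel₀ _ (zpow_ne_zero m hσ')]
  simp only [div_div_eq_mul_div, mul_div_assoc]

theorem G_eq_circleAverage {σ : ℝ} (hσ : 0 < σ) (m : ℤ) :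
    G m t a b c d σ q = qPochInf q q * Complex.sqrt t ^ m *
      Real.circleAverage (kernel m t a b c d q) 0 (1 / σ) := by
  have hσ' : (σ : ℂ) ^ m ≠ 0 := zpow_ne_zero _ (by exact_mod_cast hσ.ne')
  rw [Real.circleAverage_eq_integral_add (-Real.pi), intervalIntegral.integral_comp_add_right
    (fun θ => kernel m t a b c d q (circleMap 0 (1 / σ) θ)), zero_add,
    show 2 * Real.pi + -Real.pi = Real.pi by ring]
  simp only [G, integrand_eq hσ, intervalIntegral.integral_const_mul, div_zpow, Complex.real_smul]
  push_cast
  field_simp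

theorem differentiableAt_kernel (hq : ‖q‖ < 1) (m : ℤ) {w : ℂ} (hw : w ≠ 0)
    (hd : ∀ l, d l / w ∉ Omega q) (hc : ∀ k, t * c k * w ∉ Omega q) :
    DifferentiableAt ℂ (kernel m t a b c d q) w :=
  ((((differentiableAt_qPochInfs_div hq b hw).mul
    (differentiableAt_qPochInfs_mul hq (fun i => t * a i) w)).div
    ((differentiableAt_qPochInfs_div hq d hw).mul
    (differentiableAt_qPochInfs_mul hq (fun k => t * c k) w))
    (mul_ne_zero (qPochInfs_ne_zero hq hd) (qPochInfs_ne_zero hq hc)))).mul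
    (differentiableAt_zpow.2 (Or.inl hw))

theorem differentiableAt_kernel_of_norm (hq0 : q ≠ 0) (hq : ‖q‖ < 1) (m : ℤ) {w : ℂ} (hw : w ≠ 0)
    (hd : ∀ l, ‖d l‖ < ‖w‖) (hc : ∀ k, ‖t‖ * ‖c k‖ * ‖w‖ < 1) :
    DifferentiableAt ℂ (kernel m t a b c d q) w := by
  refine differentiableAt_kernel hq m hw (fun l => notMem_Omega_of_norm_lt_one hq0 hq ?_)
    (fun k => notMem_Omega_of_norm_lt_one hq0 hq ?_)
  · rw [norm_div, div_lt_one (norm_pos_iff.2 hw)]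
    exact hd l
  · rw [norm_mul, norm_mul]
    exact hc k

theorem norm_mul_norm_mul_lt_one (ht : t ≠ 0) {σ : ℝ} (hσ : 0 < σ) {x w : ℂ}
    (hx : ‖x‖ < σ / ‖t‖) (hw : ‖w‖ ≤ 1 / σ) : ‖t‖ * ‖x‖ * ‖w‖ < 1 :=
  calc ‖t‖ * ‖x‖ * ‖w‖ ≤ ‖t‖ * ‖x‖ * (1 / σ) := by gcongr
    _ < ‖t‖ * (σ / ‖t‖) * (1 / σ) := by
        have := norm_pos_iff.2 ht
        gcongr
    _ = 1 := by field_simp [norm_ne_zero_iff.2 ht]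

theorem intervalIntegrable_integrand (hq0 : q ≠ 0) (hq : ‖q‖ < 1) (m : ℤ) (ht : t ≠ 0) {σ : ℝ}
    (hσ : 0 < σ) (hc : ∀ k, ‖c k‖ < σ / ‖t‖) (hd : ∀ l, ‖d l‖ < 1 / σ) :
    IntervalIntegrable (integrand m t a b c d σ q) MeasureTheory.volume
      (-Real.pi) Real.pi := by
  refine Continuous.intervalIntegrable ?_ _ _
  rw [funext (integrand_eq hσ m)]
  refine continuous_const.mul (continuous_iff_continuousAt.2 fun ψ => ?_)
  have hn : ‖circleMap 0 (1 / σ) ψ‖ = 1 / σ := by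
    rw [norm_circleMap_zero, abs_of_pos (by positivity)]
  exact ContinuousAt.comp (f := circleMap 0 (1 / σ)) (differentiableAt_kernel_of_norm hq0 hq m
    (circleMap_ne_center (by positivity)) (fun l => (hd l).trans_eq hn.symm)
    fun k => norm_mul_norm_mul_lt_one ht hσ (hc k) hn.le).continuousAt
    (continuous_circleMap 0 _).continuousAt

theorem kernel_inv (ht : t ≠ 0) (m : ℤ) (w : ℂ) :
    kernel (-m) t b a d c q (t * w)⁻¹ = t ^ m * kernel m t a b c d q w := by
  have h_mul {n : ℕ} (f : Fin n → ℂ) : (fun i => t * f i * (t * w)⁻¹) = fun i => f i / w := by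
    funext i
    rw [mul_inv, mul_mul_mul_comm, mul_inv_cancel₀ ht, one_mul, div_eq_mul_inv]
  have h_div {n : ℕ} (f : Fin n → ℂ) : (fun i => f i / (t * w)⁻¹) = fun i => t * f i * w := by
    funext i
    rw [div_inv_eq_mul, mul_left_comm, mul_assoc]
  have h_pow : (t * w)⁻¹ ^ (-m) = t ^ m * w ^ m := by
    rw [inv_zpow', neg_neg, mul_zpow]
  rw [kernel, kernel, h_mul, h_mul, h_div, h_div, h_pow]
  ring

theorem sqrt_zpow_neg_mul_zpow (t : ℂ) (m : ℤ) :
    Complex.sqrt t ^ (-m) * t ^ m = Complex.sqrt t ^ m := by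
  have h : Complex.sqrt t ^ 2 = t := by simp [Complex.sqrt]
  nth_rw 2 [← h]
  rw [pow_two, mul_zpow, zpow_neg, ← mul_assoc, inv_mul_mul_self]

theorem G_eq_G_neg (ht : t ≠ 0) {σ : ℝ} (hσ : 0 < σ) (m : ℤ) :
    G m t a b c d σ q = G (-m) t b a d c (‖t‖ / σ) q := by
  have hradius : 1 / (‖t‖ / σ) = (‖t‖ * (1 / σ))⁻¹ := by
    rw [one_div, mul_one_div]
  have hσt : 0 < ‖t‖ / σ := div_pos (norm_pos_iff.2 ht) hσ
  rw [G_eq_circleAverage hσ, G_eq_circleAverage hσt, hradius, ← circleAverage_comp_inv,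
    ← circleAverage_comp_const_mul (fun w => kernel (-m) t b a d c q w⁻¹)]
  simp only [kernel_inv ht, ← smul_eq_mul (t ^ m), Real.circleAverage_fun_smul]
  rw [smul_eq_mul, ← sqrt_zpow_neg_mul_zpow t m]
  ring

theorem G_eq_of_radius_le (hq0 : q ≠ 0) (hq : ‖q‖ < 1) (m : ℤ) {σ τ : ℝ} (hσ : 0 < σ)
    (hστ : σ ≤ τ) (ht : t ≠ 0) (hc : ∀ k, ‖c k‖ < σ / ‖t‖) (hd : ∀ l, ‖d l‖ < 1 / τ) :
    G m t a b c d σ q = G m t a b c d τ q := by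
  have hτ : 0 < 1 / τ := one_div_pos.2 (hσ.trans_le hστ)
  have h := circleAverage_eq_add_sum_residues (f := kernel m t a b c d q) (s := ∅) (p := id)
    (res := 0) hτ (one_div_le_one_div_of_le hσ hστ) (by simp) (by simp)
    (fun w hτw hwσ _ => differentiableAt_kernel_of_norm hq0 hq m
      (norm_pos_iff.1 (hτ.trans_le hτw)) (fun l => (hd l).trans_le hτw)
      fun k => norm_mul_norm_mul_lt_one ht hσ (hc k) hwσ) (by simp)
  rw [G_eq_circleAverage hσ, G_eq_circleAverage (hσ.trans_le hστ), h, Finset.sum_empty, add_zero]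

theorem G_reflection (hq0 : q ≠ 0) (hq : ‖q‖ < 1) (m : ℤ) (ht : t ≠ 0) {σ : ℝ} (hσ : 0 < σ)
    (hc : ∀ k, ‖c k‖ < min (1 / σ) (σ / ‖t‖)) (hd : ∀ l, ‖d l‖ < min (1 / σ) (σ / ‖t‖)) :
    G m t a b c d σ q = G (-m) t b a d c σ q := by
  have : 0 < ‖t‖ := norm_pos_iff.2 ht
  have hbound : ‖t‖ / σ / ‖t‖ = 1 / σ := by field_simp
  have hradius : 1 / (‖t‖ / σ) = σ / ‖t‖ := one_div_div _ _
  rw [G_eq_G_neg ht hσ]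
  rcases le_total σ (‖t‖ / σ) with h | h
  · refine (G_eq_of_radius_le hq0 hq (-m) hσ h ht (fun k => (hd k).trans_le (min_le_right _ _))
      fun l => ?_).symm
    rw [hradius]
    exact (hc l).trans_le (min_le_right _ _)
  · refine G_eq_of_radius_le hq0 hq (-m) (by positivity) h ht (fun k => ?_)
      fun l => (hc l).trans_le (min_le_left _ _)
    rw [hbound]
    exact (hd k).trans_le (min_le_left _ _)

/-- The rational function `kernel (q w) / kernel w`, in a form that is defined at `w = 0` when
`B ≤ D`. Its values at the poles `d k * q ^ n` of the kernel are the ratios of consecutive terms of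
the `k`-th basic hypergeometric series. -/
noncomputable def kernelRatio (m : ℤ) (t : ℂ) (a : Fin A → ℂ) (b : Fin B → ℂ) (c : Fin C → ℂ)
    (d : Fin D → ℂ) (q w : ℂ) : ℂ :=
  q ^ m * (-(q * w)) ^ ((D : ℤ) - B) * ((∏ j, b j) / ∏ l, d l) *
    (((∏ j, (1 - q * w / b j)) * ∏ k, (1 - t * c k * w)) /
      ((∏ l, (1 - q * w / d l)) * ∏ i, (1 - t * a i * w)))

theorem prod_one_sub_div {K : Type*} [Field K] {n : ℕ} {f : Fin n → K} (hf : ∀ i, f i ≠ 0)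
    {x : K} (hx : x ≠ 0) :
    ∏ i, (1 - f i / x) = (∏ i, f i) * ((-x) ^ n)⁻¹ * ∏ i, (1 - x / f i) := by
  have h : (-x) ^ n = ∏ _i : Fin n, -x := by simp
  rw [h, ← Finset.prod_inv_distrib, ← Finset.prod_mul_distrib, ← Finset.prod_mul_distrib]
  refine Finset.prod_congr rfl fun i _ => ?_
  have := hf i
  field_simp
  ring

theorem kernel_mul (hq0 : q ≠ 0) (hq : ‖q‖ < 1) (m : ℤ) (hb0 : ∀ j, b j ≠ 0)
    (hd0 : ∀ l, d l ≠ 0) {w : ℂ} (hw : w ≠ 0) (ha : ∀ i, 1 - t * a i * w ≠ 0)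
    (hc : ∀ k, 1 - t * c k * w ≠ 0) :
    kernel m t a b c d q (q * w) = kernelRatio m t a b c d q w * kernel m t a b c d q w := by
  have hqw : q * w ≠ 0 := mul_ne_zero hq0 hw
  have h_div {n : ℕ} {f : Fin n → ℂ} (hf : ∀ i, f i ≠ 0) :
      qPochInfs (fun i => f i / (q * w)) q =
        (∏ i, f i) * ((-(q * w)) ^ n)⁻¹ * (∏ i, (1 - q * w / f i)) *
          qPochInfs (fun i => f i / w) q := by
    rw [qPochInfs_eq_prod_mul hq, prod_one_sub_div hf hqw]
    congr 2 with i
    field_simp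
  have h_mul {n : ℕ} {f : Fin n → ℂ} (hf : ∀ i, 1 - t * f i * w ≠ 0) :
      qPochInfs (fun i => t * f i * (q * w)) q =
        (∏ i, (1 - t * f i * w))⁻¹ * qPochInfs (fun i => t * f i * w) q := by
    rw [eq_inv_mul_iff_mul_eq₀ (Finset.prod_ne_zero_iff.2 fun i _ => hf i),
      qPochInfs_eq_prod_mul hq fun i => t * f i * w]
    congr 2 with i
    ring
  rw [kernel, kernel, kernelRatio, h_div hb0, h_div hd0, h_mul ha, h_mul hc,
    zpow_sub₀ (neg_ne_zero.2 hqw), zpow_natCast, zpow_natCast, mul_zpow]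
  simp only [div_eq_mul_inv, mul_inv, inv_inv]
  ring

theorem continuousAt_kernelRatio (m : ℤ) {w : ℂ} (hw : q * w ≠ 0 ∨ B ≤ D)
    (ha : ∀ i, 1 - t * a i * w ≠ 0) (hd : ∀ l, 1 - q * w / d l ≠ 0) :
    ContinuousAt (kernelRatio m t a b c d q) w := by
  unfold kernelRatio
  have hpow : ContinuousAt (fun w => (-(q * w)) ^ ((D : ℤ) - B)) w :=
    ContinuousAt.zpow₀ (by fun_prop) _ (hw.imp neg_ne_zero.2 fun h => by lia)
  have hden : (∏ l, (1 - q * w / d l)) * ∏ i, (1 - t * a i * w) ≠ 0 :=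
    mul_ne_zero (Finset.prod_ne_zero_iff.2 fun l _ => hd l)
      (Finset.prod_ne_zero_iff.2 fun i _ => ha i)
  fun_prop (disch := assumption)

theorem eventually_kernel_mul (hq0 : q ≠ 0) (hq : ‖q‖ < 1) (m : ℤ) (hb0 : ∀ j, b j ≠ 0)
    (hd0 : ∀ l, d l ≠ 0) {p : ℂ} (ha : ∀ i, 1 - t * a i * p ≠ 0)
    (hc : ∀ k, 1 - t * c k * p ≠ 0) :
    ∀ᶠ w in 𝓝[≠] p,
      kernel m t a b c d q (q * w) = kernelRatio m t a b c d q w * kernel m t a b c d q w := by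
  have h_ne {n : ℕ} {f : Fin n → ℂ} (hf : ∀ i, 1 - t * f i * p ≠ 0) :
      ∀ᶠ w in 𝓝[≠] p, ∀ i, 1 - t * f i * w ≠ 0 :=
    eventually_all.2 fun i => nhdsWithin_le_nhds <|
      ContinuousAt.eventually_ne (g := fun w => 1 - t * f i * w) (by fun_prop) (hf i)
  have h_zero : ∀ᶠ w in 𝓝[≠] p, w ≠ 0 :=
    nhdsNE_le_cofinite p (Set.finite_singleton 0).compl_mem_cofinite
  filter_upwards [h_ne ha, h_ne hc, h_zero] with w ha hc hw
    using kernel_mul hq0 hq m hb0 hd0 hw ha hc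

theorem norm_kernelRatio_zero_lt_one (m : ℤ) (hd0 : ∀ l, d l ≠ 0)
    (h : B < D ∨ B = D ∧ ‖q ^ m * ∏ j, b j‖ < ‖∏ l, d l‖) :
    ‖kernelRatio m t a b c d q 0‖ < 1 := by
  rcases h with h | ⟨rfl, h⟩
  · have hE : (D : ℤ) - B ≠ 0 := by lia
    simp [kernelRatio, zero_zpow _ hE]
  · have hd : 0 < ‖∏ l, d l‖ := norm_pos_iff.2 (Finset.prod_ne_zero_iff.2 fun l _ => hd0 l)
    simpa [kernelRatio, ← mul_div_assoc] using (div_lt_one hd).2 h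

theorem exists_norm_kernel_mul_le (hq0 : q ≠ 0) (hq : ‖q‖ < 1) (m : ℤ) (hb0 : ∀ j, b j ≠ 0)
    (hd0 : ∀ l, d l ≠ 0) (h : B < D ∨ B = D ∧ ‖q ^ m * ∏ j, b j‖ < ‖∏ l, d l‖) :
    ∃ ρ : ℝ, 0 ≤ ρ ∧ ρ < 1 ∧ ∀ᶠ w in 𝓝[≠] 0,
      ‖kernel m t a b c d q (q * w)‖ ≤ ρ * ‖kernel m t a b c d q w‖ := by
  obtain ⟨ρ, hρ, hρ1⟩ := exists_between
    (norm_kernelRatio_zero_lt_one (t := t) (a := a) (c := c) m hd0 h)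
  have hcont : ContinuousAt (kernelRatio m t a b c d q) 0 :=
    continuousAt_kernelRatio m (.inr (h.elim le_of_lt fun h => h.1.le)) (by simp) (by simp)
  refine ⟨ρ, (norm_nonneg _).trans hρ.le, hρ1, ?_⟩
  filter_upwards [eventually_kernel_mul hq0 hq m hb0 hd0 (by simp) (by simp),
    (hcont.norm.eventually_le_const hρ).filter_mono nhdsWithin_le_nhds] with w hw hρw
  rw [hw, norm_mul]
  gcongr

theorem eq_mul_pow_of_div_eq_inv_pow {K : Type*} [Field K] {q x w : K} (hq0 : q ≠ 0)
    (hw : w ≠ 0) {n : ℕ} (h : x / w = (q ^ n)⁻¹) : w = x * q ^ n := by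
  rw [(div_eq_iff hw).1 h, mul_right_comm, inv_mul_cancel₀ (pow_ne_zero n hq0), one_mul]

theorem injective_mul_pow (hq0 : q ≠ 0) (hq : ‖q‖ < 1) {ι : Type*} {d : ι → ℂ}
    (hd0 : ∀ l, d l ≠ 0) (hdd : ∀ l l', l ≠ l' → d l / d l' ∉ Omega q) :
    Function.Injective fun x : ι × ℕ => d x.1 * q ^ x.2 := by
  rintro ⟨k, n⟩ ⟨l, p⟩ h
  wlog hnp : n ≤ p generalizing k l n p
  · exact (this l p k n h.symm (le_of_not_ge hnp)).symm
  obtain ⟨j, rfl⟩ := Nat.exists_eq_add_of_le hnp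
  have hkl : d k = d l * q ^ j := mul_right_cancel₀ (pow_ne_zero n hq0) (h.trans (by ring))
  obtain rfl : l = k := by
    by_contra hne
    refine hdd l k hne ⟨j, ?_⟩
    rw [hkl, div_mul_cancel_left₀ (hd0 l)]
  have hj : q ^ j = 1 := mul_left_cancel₀ (hd0 l) (by rw [← hkl, mul_one])
  obtain rfl : j = 0 := by
    by_contra hj0
    exact (pow_lt_one₀ (norm_nonneg q) hq hj0).ne (by rw [← norm_pow, hj, norm_one])
  rfl

theorem summable_of_summable_norm_prodMk {ι κ E : Type*} [Finite ι] [NormedAddCommGroup E]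
    [CompleteSpace E] {f : ι × κ → E} (h : ∀ i, Summable fun k => ‖f (i, k)‖) : Summable f :=
  .of_norm ((summable_prod_of_nonneg fun _ => norm_nonneg _).2 ⟨h, Summable.of_finite⟩)

theorem tendsto_mul_pow_cofinite (hq : ‖q‖ < 1) {ι : Type*} [Finite ι] (d : ι → ℂ) :
    Tendsto (fun x : ι × ℕ => d x.1 * q ^ x.2) cofinite (𝓝 0) := by
  have h : Summable fun x : ι × ℕ => d x.1 * q ^ x.2 :=
    summable_of_summable_norm_prodMk fun k =>
      ((summable_geometric_of_norm_lt_one hq).mul_left (d k)).norm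
  exact h.tendsto_cofinite_zero

theorem card_botPar_sub_card_topPar (k : Fin D) :
    ((botPar t a d q k).card : ℤ) + 1 - (topPar t b c d q k).card + ((C : ℤ) - A) =
      (D : ℤ) - B := by
  have hD : 0 < D := k.pos
  simp only [botPar, topPar, Multiset.card_add, Multiset.card_map, Finset.card_val,
    Finset.card_univ, Fintype.card_fin, Finset.card_erase_of_mem (Finset.mem_univ k)]
  lia

theorem notMem_Omega_of_mem_botPar (hq0 : q ≠ 0) {k : Fin D} (hda : ∀ i, t * d k * a i ∉ Omega q)
    (hdd : ∀ l, k ≠ l → d k / d l ∉ Omega q) : ∀ y ∈ botPar t a d q k, y ∉ Omega q := by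
  intro y hy
  rcases Multiset.mem_add.1 hy with hy | hy
  · obtain ⟨i, -, rfl⟩ := Multiset.mem_map.1 hy
    exact hda i
  · obtain ⟨l, hl, rfl⟩ := Multiset.mem_map.1 hy
    rintro ⟨n, hn⟩
    refine hdd l (Finset.ne_of_mem_erase (Finset.mem_def.2 hl)).symm ⟨n + 1, ?_⟩
    rw [pow_succ, mul_inv, ← hn, mul_div_assoc, mul_right_comm, mul_inv_cancel₀ hq0, one_mul]

theorem vdBRTerm_arg_succ (m : ℤ) {k : Fin D} (hk : d k ≠ 0) (n : ℕ) :
    vdBRTerm ((C : ℤ) - A) (topPar t b c d q k) (botPar t a d q k) q (arg m b d q k) (n + 1) =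
      kernelRatio m t a b c d q (d k * q ^ n) *
        vdBRTerm ((C : ℤ) - A) (topPar t b c d q k) (botPar t a d q k) q (arg m b d q k) n := by
  have h_mul {n' : ℕ} (f : Fin n' → ℂ) : ∏ i, (1 - t * d k * f i * q ^ n) =
      ∏ i, (1 - t * f i * (d k * q ^ n)) := Finset.prod_congr rfl fun i _ => by ring
  have h_div {n' : ℕ} (f : Fin n' → ℂ) (s : Finset (Fin n')) :
      ∏ i ∈ s, (1 - q * d k / f i * q ^ n) = ∏ i ∈ s, (1 - q * (d k * q ^ n) / f i) :=
    Finset.prod_congr rfl fun i _ => by ring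
  have h_upper : ((topPar t b c d q k).map fun x => 1 - x * q ^ n).prod =
      (∏ j, (1 - q * (d k * q ^ n) / b j)) * ∏ i, (1 - t * c i * (d k * q ^ n)) := by
    simp only [topPar, Multiset.map_add, Multiset.prod_add, Multiset.map_map,
      Function.comp_apply, Finset.prod_map_val]
    rw [h_mul, h_div, mul_comm]
  have h_lower : (1 - q * q ^ n) * ((botPar t a d q k).map fun x => 1 - x * q ^ n).prod =
      (∏ l, (1 - q * (d k * q ^ n) / d l)) * ∏ i, (1 - t * a i * (d k * q ^ n)) := by
    have hkk : q * (d k * q ^ n) / d k = q * q ^ n := by field_simp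
    simp only [botPar, Multiset.map_add, Multiset.prod_add, Multiset.map_map,
      Function.comp_apply, Finset.prod_map_val]
    rw [h_mul, h_div, ← Finset.mul_prod_erase _ _ (Finset.mem_univ k), hkk]
    ring
  have h_power : (-q ^ n) ^ ((D : ℤ) - B) * arg m b d q k =
      q ^ m * (-(q * (d k * q ^ n))) ^ ((D : ℤ) - B) * ((∏ j, b j) / ∏ l, d l) := by
    rw [arg, ← mul_assoc q, ← mul_neg, mul_zpow _ (-q ^ n)]
    ring
  rw [vdBRTerm_succ, card_botPar_sub_card_topPar, h_upper, h_lower, h_power, kernelRatio]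
  ring

theorem tendsto_one_sub_div_mul_inv_qPochInf (hq0 : q ≠ 0) (hq : ‖q‖ < 1) {p : ℂ} (hp : p ≠ 0) :
    Tendsto (fun w => (1 - p / w) * (qPochInf (p / w) q)⁻¹) (𝓝[≠] p) (𝓝 (qPochInf q q)⁻¹) := by
  have h_cont : ContinuousAt (fun w => qPochInf (p / w * q) q) p :=
    (differentiable_qPochInf hq).continuous.continuousAt.comp (by fun_prop (disch := assumption))
  have h_lim : Tendsto (fun w => (qPochInf (p / w * q) q)⁻¹) (𝓝 p) (𝓝 (qPochInf q q)⁻¹) := by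
    have h := h_cont.tendsto
    rw [div_self hp, one_mul] at h
    exact h.inv₀ (qPochInf_self_ne_zero hq0 hq)
  refine (h_lim.mono_left nhdsWithin_le_nhds).congr' ?_
  filter_upwards [self_mem_nhdsWithin, nhdsNE_le_cofinite p
    (Set.finite_singleton 0).compl_mem_cofinite] with w hwp hw
  have hne : 1 - p / w ≠ 0 := sub_ne_zero.2 fun h => hwp ((div_eq_one_iff_eq hw).1 h.symm).symm
  rw [qPochInf_eq_one_sub_mul hq (p / w), mul_inv, mul_inv_cancel_left₀ hne]

theorem tendsto_one_sub_div_smul_kernel (hq0 : q ≠ 0) (hq : ‖q‖ < 1) (m : ℤ) {k : Fin D}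
    (hk : d k ≠ 0) (hdc : ∀ i, t * d k * c i ∉ Omega q) (hdd : ∀ l, l ≠ k → d l / d k ∉ Omega q) :
    Tendsto (fun w => (1 - d k / w) • kernel m t a b c d q w) (𝓝[≠] d k)
      (𝓝 (coeff m t a b c d q k / qPochInf q q)) := by
  set H : ℂ → ℂ := fun w => qPochInfs (fun i => t * a i * w) q * qPochInfs (fun j => b j / w) q *
    w ^ m / (qPochInfs (fun i => t * c i * w) q * ∏ l ∈ Finset.univ.erase k, qPochInf (d l / w) q)
  have h_comm {n : ℕ} (f : Fin n → ℂ) : (fun i => t * f i * d k) = fun i => t * d k * f i :=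
    funext fun i => mul_right_comm t (f i) (d k)
  have hHk : H (d k) = coeff m t a b c d q k := by
    simp only [H, coeff, h_comm]
  have hH : ContinuousAt H (d k) := by
    refine (((differentiableAt_qPochInfs_mul hq (fun i => t * a i) (d k)).continuousAt.mul
      (differentiableAt_qPochInfs_div hq b hk).continuousAt).mul
      (continuousAt_zpow₀ _ _ (.inl hk))).div ?_ ?_
    · exact (differentiableAt_qPochInfs_mul hq (fun i => t * c i) (d k)).continuousAt.mul
        (tendsto_finsetProd _ fun l _ => (differentiable_qPochInf hq).continuous.continuousAt.comp
          (by fun_prop (disch := assumption)))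
    · rw [h_comm]
      exact mul_ne_zero (qPochInfs_ne_zero hq hdc) (Finset.prod_ne_zero_iff.2 fun l hl =>
        qPochInf_ne_zero hq (hdd l (Finset.ne_of_mem_erase hl)))
  have h_kernel (w : ℂ) : kernel m t a b c d q w = (qPochInf (d k / w) q)⁻¹ * H w := by
    have h_erase : qPochInfs (fun l => d l / w) q =
        qPochInf (d k / w) q * ∏ l ∈ Finset.univ.erase k, qPochInf (d l / w) q :=
      (Finset.mul_prod_erase _ _ (Finset.mem_univ k)).symm
    simp only [kernel, h_erase, H]
    simp only [div_eq_mul_inv, mul_inv]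
    ring
  rw [div_eq_inv_mul, ← hHk]
  refine ((tendsto_one_sub_div_mul_inv_qPochInf hq0 hq hk).mul
    (hH.tendsto.mono_left nhdsWithin_le_nhds)).congr fun w => ?_
  rw [h_kernel, smul_eq_mul, mul_assoc]

theorem tendsto_one_sub_pole_div_smul_kernel (hq0 : q ≠ 0) (hq : ‖q‖ < 1) (m : ℤ)
    (hb0 : ∀ j, b j ≠ 0) (hd0 : ∀ l, d l ≠ 0) (hda : ∀ k i, t * d k * a i ∉ Omega q)
    (hdc : ∀ k i, t * d k * c i ∉ Omega q) (hdd : ∀ l l', l ≠ l' → d l / d l' ∉ Omega q)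
    (k : Fin D) (n : ℕ) :
    Tendsto (fun w => (1 - d k * q ^ n / w) • kernel m t a b c d q w) (𝓝[≠] (d k * q ^ n))
      (𝓝 (coeff m t a b c d q k / qPochInf q q * vdBRTerm ((C : ℤ) - A) (topPar t b c d q k)
        (botPar t a d q k) q (arg m b d q k) n)) := by
  induction n with
  | zero =>
    simpa [vdBRTerm_zero] using
      tendsto_one_sub_div_smul_kernel hq0 hq m (hd0 k) (hdc k) fun l hl => hdd l k hl
  | succ n ih =>
    have h_ne {n' : ℕ} {f : Fin n' → ℂ} (hf : ∀ i, t * d k * f i ∉ Omega q) (i : Fin n') :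
        1 - t * f i * (d k * q ^ n) ≠ 0 := by
      convert one_sub_mul_pow_ne_zero (hf i) n using 2
      ring
    have h_pole (l : Fin D) : 1 - q * (d k * q ^ n) / d l ≠ 0 := by
      rw [mul_left_comm, ← pow_succ', mul_div_right_comm]
      rcases eq_or_ne k l with rfl | hkl
      · rw [div_self (hd0 k), one_mul, pow_succ']
        exact one_sub_mul_pow_ne_zero (notMem_Omega_of_norm_lt_one hq0 hq hq) n
      · exact one_sub_mul_pow_ne_zero (hdd k l hkl) (n + 1)
    have hF := continuousAt_kernelRatio (b := b) (c := c) m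
      (.inl (mul_ne_zero hq0 (mul_ne_zero (hd0 k) (pow_ne_zero n hq0)))) (h_ne (hda k)) h_pole
    have h := tendsto_one_sub_div_smul_of_mul hq0
      (eventually_kernel_mul hq0 hq m hb0 hd0 (h_ne (hda k)) (h_ne (hdc k))) hF ih
    rw [vdBRTerm_arg_succ m (hd0 k), mul_left_comm, pow_succ', mul_left_comm (d k)]
    exact h

theorem arg_ne_zero (hq0 : q ≠ 0) (m : ℤ) (hb0 : ∀ j, b j ≠ 0) (hd0 : ∀ l, d l ≠ 0) (k : Fin D) :
    arg m b d q k ≠ 0 :=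
  mul_ne_zero (mul_ne_zero (zpow_ne_zero m hq0) (zpow_ne_zero _ (mul_ne_zero hq0 (hd0 k))))
    (div_ne_zero (Finset.prod_ne_zero_iff.2 fun j _ => hb0 j)
      (Finset.prod_ne_zero_iff.2 fun l _ => hd0 l))

theorem norm_arg_of_eq (m : ℤ) (h : B = D) (k : Fin D) :
    ‖arg m b d q k‖ = ‖q ^ m * ∏ j, b j‖ / ‖∏ l, d l‖ := by
  subst h
  rw [arg, sub_self, zpow_zero, mul_one, ← mul_div_assoc, norm_div]

theorem summable_vdBRTerm_of_lt (hq0 : q ≠ 0) (hq : ‖q‖ < 1) {k : Fin D}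
    (hda : ∀ i, t * d k * a i ∉ Omega q) (hdd : ∀ l, k ≠ l → d k / d l ∉ Omega q) (h : B < D)
    (z : ℂ) :
    Summable (vdBRTerm ((C : ℤ) - A) (topPar t b c d q k) (botPar t a d q k) q z) := by
  refine summable_vdBRTerm hq0 hq (notMem_Omega_of_mem_botPar hq0 hda hdd) (.inl ?_)
  rw [card_botPar_sub_card_topPar]
  lia

theorem summable_vdBRTerm_arg (hq0 : q ≠ 0) (hq : ‖q‖ < 1) (m : ℤ) (hd0 : ∀ l, d l ≠ 0)
    {k : Fin D} (hda : ∀ i, t * d k * a i ∉ Omega q) (hdd : ∀ l, k ≠ l → d k / d l ∉ Omega q)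
    (h : B < D ∨ B = D ∧ ‖q ^ m * ∏ j, b j‖ < ‖∏ l, d l‖) :
    Summable (vdBRTerm ((C : ℤ) - A) (topPar t b c d q k) (botPar t a d q k) q
      (arg m b d q k)) := by
  refine summable_vdBRTerm hq0 hq (notMem_Omega_of_mem_botPar hq0 hda hdd) ?_
  rw [card_botPar_sub_card_topPar]
  refine h.imp (fun h => by lia) fun h => ⟨by lia, ?_⟩
  rw [norm_arg_of_eq m h.1,
    div_lt_one (norm_pos_iff.2 (Finset.prod_ne_zero_iff.2 fun l _ => hd0 l))]
  exact h.2

theorem seriesDiverges_vdBRTerm_arg (hq0 : q ≠ 0) (hq : ‖q‖ < 1) (m : ℤ) (hb0 : ∀ j, b j ≠ 0)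
    (hd0 : ∀ l, d l ≠ 0) {k : Fin D} (hda : ∀ i, t * d k * a i ∉ Omega q)
    (hdd : ∀ l, k ≠ l → d k / d l ∉ Omega q) (htop : ∀ x ∈ topPar t b c d q k, x ∉ Omega q)
    (h : D < B ∨ B = D ∧ ‖∏ l, d l‖ ≤ ‖q ^ m * ∏ j, b j‖) :
    SeriesDiverges (vdBRTerm ((C : ℤ) - A) (topPar t b c d q k) (botPar t a d q k) q
      (arg m b d q k)) := by
  refine seriesDiverges_vdBRTerm hq0 hq htop (notMem_Omega_of_mem_botPar hq0 hda hdd)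
    (arg_ne_zero hq0 m hb0 hd0 k) ?_
  rw [card_botPar_sub_card_topPar]
  refine h.imp (fun h => by lia) fun h => ⟨by lia, ?_⟩
  rw [norm_arg_of_eq m h.1,
    one_le_div (norm_pos_iff.2 (Finset.prod_ne_zero_iff.2 fun l _ => hd0 l))]
  exact h.2

theorem circleAverage_kernel_eq_sum_vdBR (hq0 : q ≠ 0) (hq : ‖q‖ < 1) (m : ℤ) {R : ℝ} (hR : 0 < R)
    (hc : ∀ i (w : ℂ), ‖w‖ ≤ R → ‖t‖ * ‖c i‖ * ‖w‖ < 1) (hd : ∀ l, ‖d l‖ < R)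
    (hb0 : ∀ j, b j ≠ 0) (hd0 : ∀ l, d l ≠ 0) (hda : ∀ k i, t * d k * a i ∉ Omega q)
    (hdd : ∀ l l', l ≠ l' → d l / d l' ∉ Omega q)
    (h : B < D ∨ B = D ∧ ‖q ^ m * ∏ j, b j‖ < ‖∏ l, d l‖) :
    Real.circleAverage (kernel m t a b c d q) 0 R = ∑ k, coeff m t a b c d q k / qPochInf q q *
      vdBR ((C : ℤ) - A) (topPar t b c d q k) (botPar t a d q k) q (arg m b d q k) := by
  have htc {w : ℂ} (hw : ‖w‖ ≤ R) (i : Fin C) : t * c i * w ∉ Omega q :=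
    notMem_Omega_of_norm_lt_one hq0 hq (by simpa only [norm_mul] using hc i w hw)
  let res : Fin D × ℕ → ℂ := fun x => coeff m t a b c d q x.1 / qPochInf q q *
    vdBRTerm ((C : ℤ) - A) (topPar t b c d q x.1) (botPar t a d q x.1) q (arg m b d q x.1) x.2
  have hsum : Summable res := summable_of_summable_norm_prodMk fun k =>
    ((summable_vdBRTerm_arg (c := c) hq0 hq m hd0 (hda k) (hdd k) h).mul_left
      (coeff m t a b c d q k / qPochInf q q)).norm
  have hres (x : Fin D × ℕ) : Tendsto (fun w => (1 - d x.1 * q ^ x.2 / w) •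
      kernel m t a b c d q w) (𝓝[≠] (d x.1 * q ^ x.2)) (𝓝 (res x)) := by
    refine tendsto_one_sub_pole_div_smul_kernel hq0 hq m hb0 hd0 hda (fun k i => ?_) hdd x.1 x.2
    rw [mul_right_comm]
    exact htc (hd k).le i
  have hpR (x : Fin D × ℕ) : ‖d x.1 * q ^ x.2‖ < R := by
    rw [norm_mul, norm_pow]
    exact (mul_le_of_le_one_right (norm_nonneg _)
      (pow_le_one₀ (norm_nonneg q) hq.le)).trans_lt (hd x.1)
  have hf (w : ℂ) (hw : w ≠ 0) (hwR : ‖w‖ ≤ R)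
      (hw_pole : w ∉ Set.range fun x : Fin D × ℕ => d x.1 * q ^ x.2) :
      DifferentiableAt ℂ (kernel m t a b c d q) w := by
    refine differentiableAt_kernel hq m hw (fun l => ?_) (htc hwR)
    rintro ⟨n, hn⟩
    exact hw_pole ⟨(l, n), (eq_mul_pow_of_div_eq_inv_pow hq0 hw hn).symm⟩
  obtain ⟨ρ, hρ0, hρ, hdecay⟩ :=
    exists_norm_kernel_mul_le (t := t) (a := a) (c := c) hq0 hq m hb0 hd0 h
  calc Real.circleAverage (kernel m t a b c d q) 0 R = ∑' x, res x :=
        circleAverage_eq_tsum_residues_of_norm_mul_le hq0 hq (injective_mul_pow hq0 hq hd0 hdd)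
          (fun x => mul_ne_zero (hd0 x.1) (pow_ne_zero x.2 hq0)) (tendsto_mul_pow_cofinite hq d)
          hR hpR hf hres hsum hρ0 hρ hdecay
    _ = ∑ k, ∑' n, res (k, n) := by rw [hsum.tsum_prod, tsum_fintype]
    _ = _ := by simp only [res, tsum_mul_left, vdBR]

theorem sqrt_zpow (t : ℂ) (m : ℤ) : Complex.sqrt t ^ m = t ^ ((m : ℂ) / 2) := by
  rw [Complex.sqrt, ← Complex.cpow_mul_int, div_eq_mul_inv, mul_comm]

theorem G_eq_sum_vdBR (hq0 : q ≠ 0) (hq : ‖q‖ < 1) (m : ℤ) (ht : t ≠ 0) {σ : ℝ} (hσ : 0 < σ)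
    (hc : ∀ k, ‖c k‖ < σ / ‖t‖) (hd : ∀ l, ‖d l‖ < 1 / σ)
    (hb0 : ∀ j, b j ≠ 0) (hd0 : ∀ l, d l ≠ 0) (hda : ∀ k i, t * d k * a i ∉ Omega q)
    (hdd : ∀ l l', l ≠ l' → d l / d l' ∉ Omega q)
    (h : B < D ∨ B = D ∧ ‖q ^ m * ∏ j, b j‖ < ‖∏ l, d l‖) :
    G m t a b c d σ q = t ^ ((m : ℂ) / 2) * ∑ k : Fin D, coeff m t a b c d q k *
      vdBR ((C : ℤ) - A) (topPar t b c d q k) (botPar t a d q k) q (arg m b d q k) := by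
  rw [G_eq_circleAverage hσ, circleAverage_kernel_eq_sum_vdBR hq0 hq m (one_div_pos.2 hσ)
    (fun i w => norm_mul_norm_mul_lt_one ht hσ (hc i)) hd hb0 hd0 hda hdd h, ← sqrt_zpow,
    mul_comm (qPochInf q q), mul_assoc, Finset.mul_sum]
  simp only [div_mul_eq_mul_div, mul_div_cancel₀ _ (qPochInf_self_ne_zero hq0 hq)]

end QSeries

open QSeries in
theorem mainTheorem1 {A B C D : ℕ} (q : ℂ) (hq0 : q ≠ 0) (hq1 : ‖q‖ < 1) (m : ℤ)
    (t : ℂ) (ht : t ≠ 0) (σ : ℝ) (hσ : 0 < σ)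
    (a : Fin A → ℂ) (b : Fin B → ℂ) (c : Fin C → ℂ) (d : Fin D → ℂ)
    (hc : ∀ k, ‖c k‖ < σ / ‖t‖) (hd : ∀ l, ‖d l‖ < 1 / σ) :
    -- the integral exists
    IntervalIntegrable (integrand m t a b c d σ q) MeasureTheory.volume (-Real.pi) Real.pi ∧
    -- reflection symmetry
    ((∀ k, ‖c k‖ < min (1 / σ) (σ / ‖t‖)) → (∀ l, ‖d l‖ < min (1 / σ) (σ / ‖t‖)) →
      G m t a b c d σ q = G (-m) t b a d c σ q) ∧
    -- the expansion over the poles `d_k`, with the convergence behaviour of its series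
    ((∀ l, d l ≠ 0) → (∀ j, b j ≠ 0) → (∀ k i, t * d k * a i ∉ Omega q) →
      (∀ l l', l ≠ l' → d l / d l' ∉ Omega q) →
      ((B < D ∨ (B = D ∧ ‖q ^ m * ∏ j, b j‖ < ‖∏ l, d l‖)) →
        G m t a b c d σ q = t ^ ((m : ℂ) / 2) * ∑ k : Fin D, coeff m t a b c d q k *
          vdBR ((C : ℤ) - A) (topPar t b c d q k) (botPar t a d q k) q (arg m b d q k)) ∧
      (B < D → ∀ k : Fin D,
        (∀ z : ℂ, Summable
          (vdBRTerm ((C : ℤ) - A) (topPar t b c d q k) (botPar t a d q k) q z)) ∧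
        Differentiable ℂ
          (fun z => vdBR ((C : ℤ) - A) (topPar t b c d q k) (botPar t a d q k) q z)) ∧
      (B = D → ‖q ^ m * ∏ j, b j‖ < ‖∏ l, d l‖ → ∀ k : Fin D, Summable
        (vdBRTerm ((C : ℤ) - A) (topPar t b c d q k) (botPar t a d q k) q (arg m b d q k))) ∧
      ((D < B ∨ (B = D ∧ ‖∏ l, d l‖ ≤ ‖q ^ m * ∏ j, b j‖)) → ∀ k : Fin D,
        (∀ x ∈ topPar t b c d q k, x ∉ Omega q) → SeriesDiverges
        (vdBRTerm ((C : ℤ) - A) (topPar t b c d q k) (botPar t a d q k) q (arg m b d q k)))) ∧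
    -- the expansion over the poles `c_k`, with the convergence behaviour of its series
    ((∀ k, c k ≠ 0) → (∀ i, a i ≠ 0) → (∀ k j, t * c k * b j ∉ Omega q) →
      (∀ k k', k ≠ k' → c k / c k' ∉ Omega q) →
      ((A < C ∨ (A = C ∧ ‖q ^ (-m) * ∏ i, a i‖ < ‖∏ k, c k‖)) →
        G m t a b c d σ q = 1 / t ^ ((m : ℂ) / 2) * ∑ k : Fin C, coeff (-m) t b a d c q k *
          vdBR ((D : ℤ) - B) (topPar t a d c q k) (botPar t b c q k) q (arg (-m) a c q k)) ∧
      (A < C → ∀ k : Fin C,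
        (∀ z : ℂ, Summable
          (vdBRTerm ((D : ℤ) - B) (topPar t a d c q k) (botPar t b c q k) q z)) ∧
        Differentiable ℂ
          (fun z => vdBR ((D : ℤ) - B) (topPar t a d c q k) (botPar t b c q k) q z)) ∧
      (A = C → ‖q ^ (-m) * ∏ i, a i‖ < ‖∏ k, c k‖ → ∀ k : Fin C, Summable
        (vdBRTerm ((D : ℤ) - B) (topPar t a d c q k) (botPar t b c q k) q (arg (-m) a c q k))) ∧
      ((C < A ∨ (A = C ∧ ‖∏ k, c k‖ ≤ ‖q ^ (-m) * ∏ i, a i‖)) → ∀ k : Fin C,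
        (∀ x ∈ topPar t a d c q k, x ∉ Omega q) → SeriesDiverges
        (vdBRTerm ((D : ℤ) - B) (topPar t a d c q k) (botPar t b c q k) q
          (arg (-m) a c q k)))) := by
  have : 0 < ‖t‖ := norm_pos_iff.2 ht
  have hc' (k) : ‖c k‖ < 1 / (‖t‖ / σ) := (hc k).trans_eq (by rw [one_div_div])
  have hd' (l) : ‖d l‖ < ‖t‖ / σ / ‖t‖ := (hd l).trans_eq (by field_simp)
  refine ⟨intervalIntegrable_integrand hq0 hq1 m ht hσ hc hd, G_reflection hq0 hq1 m ht hσ,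
    fun hd0 hb0 hda hdd => ⟨?_, fun h k => ?_, fun h h' k => ?_, fun h k htop => ?_⟩,
    fun hc0 ha0 hcb hcc => ⟨fun h => ?_, fun h k => ?_, fun h h' k => ?_, fun h k htop => ?_⟩⟩
  · exact G_eq_sum_vdBR hq0 hq1 m ht hσ hc hd hb0 hd0 hda hdd
  · have hs := summable_vdBRTerm_of_lt (b := b) (c := c) hq0 hq1 (hda k) (hdd k) h
    exact ⟨hs, differentiable_vdBR hs⟩
  · exact summable_vdBRTerm_arg hq0 hq1 m hd0 (hda k) (hdd k) (.inr ⟨h, h'⟩)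
  · exact seriesDiverges_vdBRTerm_arg hq0 hq1 m hb0 hd0 (hda k) (hdd k) htop h
  · rw [G_eq_G_neg ht hσ, G_eq_sum_vdBR hq0 hq1 (-m) ht (by positivity) hd' hc' ha0 hc0 hcb hcc h,
      Int.cast_neg, neg_div, Complex.cpow_neg, one_div]
  · have hs := summable_vdBRTerm_of_lt (b := a) (c := d) hq0 hq1 (hcb k) (hcc k) h
    exact ⟨hs, differentiable_vdBR hs⟩
  · exact summable_vdBRTerm_arg hq0 hq1 (-m) hc0 (hcb k) (hcc k) (.inr ⟨h, h'⟩)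
  · exact seriesDiverges_vdBRTerm_arg hq0 hq1 (-m) ha0 hc0 (hcb k) (hcc k) htop h
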